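/- **Definitions.** Let $\mathcal Q$ be a set of words on the letters $\bullet,\blacklozenge,\blacktriangle$. A word $w_1\cdots w_k\in\mathcal Q$ is identified with the necklace whose pearls are, in clockwise cyclic order, $\square,w_1,\dots,w_k$. All trees below are finite plane trees whose vertices are copies of necklaces of $\mathcal Q$ and whose edges join pearls of different vertices, each pearl being incident to at most one edge; a pearl incident to no edge is *free*, one free pearl is distinguished as the root, and the size $|\tau|$ of a tree $\tau$ is its number of vertices. A *rooted $\mathcal Q$-tree* is such a tree, rooted at a $\square$-pearl, all of whose edges are of type $\bullet$–$\square$ or $\blacklozenge$–$\square$ and whose free pearls are exactly the root and the $\blacktriangle$-pearls. The excess of a pearl $x$ is the number of $\blacktriangle$-pearls minus the number of $\blacklozenge$-pearls in the subtree planted at $x$ ($x$ included); the excess of the tree is that of its root. The tree is *non-negative* if every pearl has non-negative excess. Let $\mathcal F_0$ be the set of non-negative $\mathcal Q$-trees with excess $0$, and $\mathcal F_0^{\blacklozenge}$ the set of trees of $\mathcal F_0$ with a marked $\blacklozenge$-pearl. A *$\square$-rooted $\mathcal Q$-companion tree without defects* is such a tree, rooted at a $\square$-pearl, all of whose edges are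 of type $\bullet$–$\square$ or $\blacklozenge$–$\blacktriangle$, and all of whose free pearls are $\square$-pearls. Let $\mathbf C_\square$ be the set of these. Walk counterclockwise around such a tree, starting at the root; write an opening parenthesis in the right corner of each $\blacklozenge$-pearl (the corner at the pearl that immediately precedes its edge on the counterclockwise walk around its vertex) and a closing parenthesis at each free $\square$-pearl, and match the parentheses of this cyclic word in the usual way. The tree is *balanced* if the closing parenthesis of the root remains unmatched, *unbalanced* otherwise; $\mathbf B_0$ and $\mathbf U_0$ denote the sets of balanced and unbalanced trees of $\mathbf C_\square$. **Statement.** (1) For every $\mathcal Q$ there is a bijection $$\mathcal F_0\sqcup\mathcal F_0^{\blacklozenge}\;\cong\;\mathbf B_0\cup\mathbf U_0=\mathbf C_\square ,\qquad \mathbf B_0\cap\mathbf U_0=\emptyset,$$ that sends $\mathcal F_0$ to $\mathbf B_0$ and $\mathcal F_0^{\blacklozenge}$ to $\mathbf U_0$ and is necklace-preserving: a tree and its image have the same multiset of necklaces. Each of $\mathcal F_0$, $\mathcal F_0^{\blacklozenge}$, $\mathbf C_\square$ has finitely many elements of each size, and the generating functions $f=\sum_{\tau\in\mathcal F_0}t^{|\tau|}$,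 $f^{\blacklozenge}=\sum_{\tau\in\mathcal F_0^{\blacklozenge}}t^{|\tau|}$, $C_\square=\sum_{\tau\in\mathbf C_\square}t^{|\tau|}$ satisfy $$f+f^{\blacklozenge}=C_\square .$$ (2) For $\mathcal Q_\lambda=\{\bullet\bullet,\blacktriangle,\blacklozenge\}$, the series $C_\square$ is the unique formal power series solution in $\mathbb Z[[t]]$ of $$C_\square\,(1-tC_\square)(1-2tC_\square)=2t^2 .$$ Put $c_n=[t^{3n-1}]\,C_\square$. A closed planar $\lambda$-term is a unary-binary tree, whose leaves are called variables, unary nodes abstractions and binary nodes applications, that admits a bijection from its abstractions to its variables mapping each abstraction to a variable in its subtree. For every $n\ge 1$ the number of closed planar $\lambda$-terms with $n$ abstractions is $\dfrac{c_n}{n+1}$. -/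

import Mathlib

open scoped PowerSeries

/-! ### Pearls, necklaces and pearl-rooted plane trees -/

/-- The three letters of the words that encode necklaces: `●`, `♦`, `▲`. -/
inductive Bead
  | disc
  | diamond
  | triangle
  deriving DecidableEq

/-- The pearls carried by vertices: the `□`-pearl and the three kinds of beads. The necklace of a
word `w₁ … w_k` is the clockwise cyclic sequence `□, w₁, …, w_k`. -/
inductive Pearl
  | square
  | bead (b : Bead)
  deriving DecidableEq

namespace Pearl

abbrev disc : Pearl := bead .disc
abbrev diamond : Pearl := bead .diamond
abbrev triangle : Pearl := bead .triangle

/-- The letter of a pearl, if it is not a `□`-pearl. -/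
def bead? : Pearl → Option Bead
  | square => none
  | bead b => some b

end Pearl

/-- The word of a vertex whose pearls are `c` in clockwise cyclic order: the letters read
clockwise, starting just after the `□`-pearl. -/
def necklaceWord (c : List Pearl) : List Bead :=
  (c.rotate (c.idxOf .square)).filterMap Pearl.bead?

/-- What hangs at the pearls of a vertex, other than the pearl from which the vertex is reached, in
clockwise order starting after that pearl. A pearl `x` is either free, or it is joined by an edge
to the pearl `y` of another vertex, whose remaining pearls in clockwise order after `y` are
described by `sub`. The description of the pearls that follow `x` on the vertex is `rest`. -/
inductive Limbs
  | nil
  | free (x : Pearl) (rest : Limbs)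
  | edge (x y : Pearl) (sub rest : Limbs)

namespace Limbs

/-- The pearls of the vertex itself (clockwise, without the one from which it is reached). -/
def row : Limbs → List Pearl
  | nil => []
  | free x rest => x :: rest.row
  | edge x _ _ rest => x :: rest.row

/-- All the pearls described: those of the vertex and those of all the vertices beyond. -/
def pearls : Limbs → List Pearl
  | nil => []
  | free x rest => x :: rest.pearls
  | edge x y sub rest => x :: y :: (sub.pearls ++ rest.pearls)

/-- The vertices beyond the current one, each given by its clockwise cyclic sequence of pearls. -/
def vertices : Limbs → List (List Pearl)
  | nil => []
  | free _ rest => rest.vertices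
  | edge _ y sub rest => (y :: sub.row) :: (sub.vertices ++ rest.vertices)

/-- The edges, each given by its two end pearls. -/
def edges : Limbs → List (Pearl × Pearl)
  | nil => []
  | free _ rest => rest.edges
  | edge x y sub rest => (x, y) :: (sub.edges ++ rest.edges)

/-- The free pearls. -/
def frees : Limbs → List Pearl
  | nil => []
  | free x rest => x :: rest.frees
  | edge _ _ sub rest => sub.frees ++ rest.frees

end Limbs

/-- A finite plane tree rooted at a pearl. The root pearl is free. The vertices carry pearls in
clockwise cyclic order, and the edges join pearls of different vertices; the colour of an edge is
determined by its two ends (`●—□` black, `♦—□` red, `♦—▲` blue). -/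
structure PearlTree where
  root : Pearl
  limbs : Limbs

namespace PearlTree

/-- All the pearls of the tree, in the order of the clockwise walk around it from the root. -/
def pearls (τ : PearlTree) : List Pearl := τ.root :: τ.limbs.pearls

/-- The vertices, each given by its clockwise cyclic sequence of pearls. -/
def vertices (τ : PearlTree) : List (List Pearl) := (τ.root :: τ.limbs.row) :: τ.limbs.vertices

/-- The size: the number of vertices. -/
def size (τ : PearlTree) : ℕ := τ.vertices.length

/-- The multiset of the necklaces of the vertices, written as words. -/
def necklaces (τ : PearlTree) : Multiset (List Bead) := ↑(τ.vertices.map necklaceWord)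

/-- Each vertex is a copy of a necklace of `Q`. -/
def HasNecklacesIn (Q : Set (List Bead)) (τ : PearlTree) : Prop :=
  ∀ c ∈ τ.vertices, c.count .square = 1 ∧ necklaceWord c ∈ Q

end PearlTree

/-! ### Non-negative `Q`-trees -/

/-- `x` and `y` are, in some order, of the kinds `a` and `b`. -/
def Joins (a b x y : Pearl) : Prop := (x = a ∧ y = b) ∨ (x = b ∧ y = a)

/-- Rooted `Q`-trees: `□`-rooted, with black edges `●—□` and red edges `♦—□`; the only free pearls
are the root and the `▲`-pearls, and all the `▲`-pearls are free. -/
def IsQTree (Q : Set (List Bead)) (τ : PearlTree) : Prop :=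
  τ.root = .square ∧ τ.HasNecklacesIn Q ∧
    (∀ e ∈ τ.limbs.edges, Joins .disc .square e.1 e.2 ∨ Joins .diamond .square e.1 e.2) ∧
    ∀ x ∈ τ.limbs.frees, x = .triangle

/-- The number of `▲`-pearls minus the number of `♦`-pearls. -/
def excess (l : List Pearl) : ℤ := (l.count .triangle : ℤ) - (l.count .diamond : ℤ)

/-- Every pearl has non-negative excess, the excess of a pearl being that of the subtree planted at
it, the pearl included. -/
def Limbs.NonNeg : Limbs → Prop
  | .nil => True
  | .free x rest => 0 ≤ excess [x] ∧ rest.NonNeg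
  | .edge x y sub rest =>
      0 ≤ excess (x :: y :: sub.pearls) ∧ 0 ≤ excess (y :: sub.pearls) ∧ sub.NonNeg ∧ rest.NonNeg

/-- Non-negative `Q`-trees. -/
def IsNonNegQTree (Q : Set (List Bead)) (τ : PearlTree) : Prop :=
  IsQTree Q τ ∧ 0 ≤ excess τ.pearls ∧ τ.limbs.NonNeg

/-- `𝓕₀`: the non-negative `Q`-trees with excess `0`. -/
def F₀ (Q : Set (List Bead)) : Set PearlTree := {τ | IsNonNegQTree Q τ ∧ excess τ.pearls = 0}

/-- `𝓕₀^♦`: the non-negative `Q`-trees with excess `0` and a marked `♦`-pearl. The mark is the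
position of the pearl in the list of all the pearls of the tree. -/
def F₀diamond (Q : Set (List Bead)) : Set (PearlTree × ℕ) :=
  {p | p.1 ∈ F₀ Q ∧ p.1.pearls[p.2]? = some .diamond}

/-! ### `Q`-companion trees -/

/-- Rooted `Q`-companion trees: pearl-rooted, with black edges `●—□` and blue edges `♦—▲`; no
`●`- or `♦`-pearl other than the root is free. -/
def IsCompanionTree (Q : Set (List Bead)) (τ : PearlTree) : Prop :=
  τ.HasNecklacesIn Q ∧
    (∀ e ∈ τ.limbs.edges, Joins .disc .square e.1 e.2 ∨ Joins .diamond .triangle e.1 e.2) ∧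
    ∀ x ∈ τ.limbs.frees, x ≠ .disc ∧ x ≠ .diamond

/-- No defects, i.e. no free `▲`-pearls other than the root. -/
def PearlTree.NoDefects (τ : PearlTree) : Prop := Pearl.triangle ∉ τ.limbs.frees

/-- `𝐂_□`: the `□`-rooted `Q`-companion trees without defects. -/
def Csquare (Q : Set (List Bead)) : Set PearlTree :=
  {τ | IsCompanionTree Q τ ∧ τ.root = .square ∧ τ.NoDefects}

/-- The half-edge grown in the corner of a free pearl for the inverse closure: outgoing (`U`) at a
`♦`-pearl, incoming (`D`) at a `□`-pearl. -/
def cornerOfFree : Pearl → List DyckStep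
  | .square => [.D]
  | .bead .diamond => [.U]
  | _ => []

/-- The outgoing half-edge grown at a pearl that carries an edge, if it is a `♦`-pearl. -/
def cornerOfLinked : Pearl → List DyckStep
  | .bead .diamond => [.U]
  | _ => []

/-- The half-edges met on the counterclockwise walk around what hangs at a vertex. At a `♦`-pearl
that carries an edge the half-edge grows in the right corner, the one that precedes the edge on
the counterclockwise walk around its vertex. Hence it is met before the walk along an edge that
leaves from a `♦`-pearl `x`, and just before the walk returns along an edge that arrived at a
`♦`-pearl `y`. -/
def Limbs.contour : Limbs → List DyckStep
  | .nil => []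
  | .free x rest => rest.contour ++ cornerOfFree x
  | .edge x y sub rest =>
      rest.contour ++ (cornerOfLinked x ++ sub.contour ++ cornerOfLinked y)

/-- The cyclic sequence of half-edges met on the counterclockwise walk around the tree, starting at
the root pearl. -/
def PearlTree.contour (τ : PearlTree) : List DyckStep := cornerOfFree τ.root ++ τ.limbs.contour

/-- In the closure of the cyclic sequence `l` of half-edges, the outgoing half-edge at position `i`
is matched to the incoming half-edge at position `j`: the half-edges met strictly between them,
on the way from `i` to `j`, are matched among themselves. -/
def ClosureMatches (l : List DyckStep) (i j : ℕ) : Prop :=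
  i < l.length ∧ ∃ (m : DyckWord) (r : List DyckStep),
    l.rotate i = .U :: (m.toList ++ .D :: r) ∧ j = (i + m.toList.length + 1) % l.length

/-- A `□`-rooted companion tree is balanced if its root (at position `0` of the contour) remains
unmatched in the inverse closure. -/
def PearlTree.Balanced (τ : PearlTree) : Prop := ∀ i, ¬ ClosureMatches τ.contour i 0

/-- `𝐁₀`: the balanced `□`-rooted `Q`-companion trees without defects. -/
def B₀ (Q : Set (List Bead)) : Set PearlTree := {τ | τ ∈ Csquare Q ∧ τ.Balanced}

/-- `𝐔₀`: the unbalanced `□`-rooted `Q`-companion trees without defects. -/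
def U₀ (Q : Set (List Bead)) : Set PearlTree := {τ | τ ∈ Csquare Q ∧ ¬ τ.Balanced}

/-! ### Generating functions -/

/-- The generating function `∑_{a ∈ S} t^{|a|}` of a class `S` with size function `|·|` (meaningful
when there are finitely many elements of each size). -/
noncomputable def genFun {α : Type} (S : Set α) (size : α → ℕ) : ℕ⟦X⟧ :=
  PowerSeries.mk fun n => {a ∈ S | size a = n}.ncard

/-! ### Planar `λ`-terms -/

/-- The set `{●●, ▲, ♦}` of necklaces. -/
def Qlambda : Set (List Bead) := {[.disc, .disc], [.triangle], [.diamond]}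

/-- Unary-binary trees: leaves are variables, unary nodes abstractions, binary nodes
applications. -/
inductive UBTree
  | var
  | abs (t : UBTree)
  | app (t u : UBTree)

namespace UBTree

/-- The subtree at an address (the list of the turns from the root), if the address is valid. -/
def subtreeAt : UBTree → List Bool → Option UBTree
  | t, [] => some t
  | abs t, false :: p => t.subtreeAt p
  | app t _, false :: p => t.subtreeAt p
  | app _ u, true :: p => u.subtreeAt p
  | _, _ => none

/-- The abstractions of `t`, as addresses. -/
def Abstractions (t : UBTree) : Set (List Bool) := {p | ∃ s, t.subtreeAt p = some (abs s)}

/-- The variables of `t`, as addresses. -/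
def Variables (t : UBTree) : Set (List Bool) := {p | t.subtreeAt p = some var}

/-- `m` maps injectively each abstraction to a variable in its subtree. -/
def IsBinding (t : UBTree) (m : t.Abstractions → t.Variables) : Prop :=
  Function.Injective m ∧ ∀ a, a.1 <+: (m a).1

/-- `t` is a closed planar `λ`-term: it admits a binding that leaves no variable free. -/
def IsClosedPlanar (t : UBTree) : Prop := ∃ m, t.IsBinding m ∧ Function.Surjective m

end UBTree

/-- The closed planar `λ`-terms with `n` abstractions. -/
def closedPlanarTerms (n : ℕ) : Set UBTree := {t | t.IsClosedPlanar ∧ t.Abstractions.ncard = n}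

/-!
Walk counterclockwise around a companion tree and record its `♦`-pearls as up steps and its free
`□`-pearls as down steps: the tree is balanced when the steps after the root form a Dyck word.
In a non-negative `Q`-tree of excess `0`, proceed from the leaves to the root and reattach each
`♦`-pearl carrying a `□`-pearl to the last free `▲`-pearl met on the walk around the subtree planted
at it; non-negativity supplies this `▲`-pearl, and the `□`-pearl becomes free. This gives a
bijection onto the balanced trees, inverted by undoing the matching of the walk.

By the cycle lemma each companion tree, forgetting its root, has a single free `□`-pearl at which
rerooting makes it balanced. Hence unbalanced trees are balanced trees with a marked free `□`-pearl
other than the root, and a balanced tree has as many of these as it has `♦`-pearls.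

For `Qlambda`, cutting a companion tree at its root vertex expresses the generating function of
`Csquare` through itself and yields the cubic. A closed planar `λ`-term with `n` abstractions is a
tree of `F₀` of size `3n - 1` with `n` `♦`-pearls, so the coefficient of `t^(3n-1)` in
`f + f^♦ = C_□` is `n + 1` times the number of terms.
-/

/-! ### Words of up steps, down steps and markers -/

lemma append_eq_append_cons_iff {α : Type*} {a b l r : List α} {d : α} :
    a ++ b = l ++ d :: r ↔
      (∃ r', a = l ++ d :: r' ∧ r = r' ++ b) ∨ ∃ l', l = a ++ l' ∧ b = l' ++ d :: r := by
  rw [List.append_eq_append_iff]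
  constructor
  · rintro (⟨c, hl, hb⟩ | ⟨_ | ⟨_, c⟩, ha, hr⟩) <;> simp_all
  · rintro (⟨c, hl, hb⟩ | ⟨c, ha, hr⟩) <;> simp_all

lemma append_cons_eq_append_cons_iff {α : Type*} {a b a' b' : List α} {d d' : α} :
    a ++ d :: b = a' ++ d' :: b' ↔ (a = a' ∧ d = d' ∧ b = b') ∨
      (∃ c, a = a' ++ d' :: c ∧ b' = c ++ d :: b) ∨ ∃ c, a' = a ++ d :: c ∧ b = c ++ d' :: b' := by
  rw [append_eq_append_cons_iff]
  constructor
  · rintro (h | ⟨_ | ⟨_, c⟩, ha, hb⟩) <;> simp_all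
  · rintro (⟨rfl, rfl, rfl⟩ | h | ⟨c, rfl, rfl⟩)
    · exact .inr ⟨[], by simp⟩
    · exact .inl h
    · exact .inr ⟨d :: c, by simp⟩

/-- Words of up steps, down steps and markers `none`. The markers stand for the free `▲`-pearls met
on the walk around a tree. -/
abbrev MarkedWord : Type := List (Option DyckStep)

namespace MarkedWord

/-- The height reached from height `h` along a word, if the word never goes below `0` and only meets
markers at height `0`. -/
@[simp] def run : ℕ → MarkedWord → Option ℕ
  | h, [] => some h
  | h, some .U :: l => run (h + 1) l
  | 0, some .D :: _ => none
  | h + 1, some .D :: l => run h l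
  | 0, none :: l => run 0 l
  | _ + 1, none :: _ => none

/-- The number of up steps minus the number of down steps. -/
def rise (l : MarkedWord) : ℤ := (l.count (some .U) : ℤ) - l.count (some .D)

@[simp] lemma rise_nil : rise [] = 0 := rfl

@[simp] lemma rise_append (a b : MarkedWord) : rise (a ++ b) = rise a + rise b := by
  simp only [rise, List.count_append]; push_cast; ring

@[simp] lemma rise_up_cons (l : MarkedWord) : rise (some .U :: l) = rise l + 1 := by
  simp [rise]; ring

@[simp] lemma rise_down_cons (l : MarkedWord) : rise (some .D :: l) = rise l - 1 := by
  simp [rise]; ring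

@[simp] lemma rise_marker_cons (l : MarkedWord) : rise (none :: l) = rise l := by
  simp [rise]

variable {h j k m : ℕ} {a b a' b' l : MarkedWord}

lemma run_append (h : ℕ) (a b : MarkedWord) :
    run h (a ++ b) = (run h a).bind fun k => run k b := by
  induction a generalizing h with
  | nil => simp
  | cons c a ih => rcases c with _ | _ | _ <;> cases h <;> simp [ih]

lemma run_append_eq_some :
    run h (a ++ b) = some m ↔ ∃ k, run h a = some k ∧ run k b = some m := by
  rw [run_append, Option.bind_eq_some_iff]

lemma run_down_cons_eq_some :
    run h (some .D :: l) = some m ↔ ∃ k, h = k + 1 ∧ run k l = some m := by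
  cases h <;> simp

lemma run_marker_cons_eq_some : run h (none :: l) = some m ↔ h = 0 ∧ run 0 l = some m := by
  cases h <;> simp

lemma eq_add_rise_of_run (H : run h l = some k) : (k : ℤ) = h + rise l := by
  induction l generalizing h with
  | nil => simpa [eq_comm] using H
  | cons c l ih =>
    rcases c with _ | _ | _ <;> cases h <;> simp only [run, reduceCtorEq] at H <;>
      · have := ih H
        simp only [rise_marker_cons, rise_up_cons, rise_down_cons]
        push_cast at *
        linarith

lemma run_append_eq_zero_of_rise_eq_zero (H : run 0 (a ++ b) = some 0) (ha : rise a = 0) :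
    run 0 a = some 0 ∧ run 0 b = some 0 := by
  obtain ⟨k, hk, hb⟩ := run_append_eq_some.1 H
  obtain rfl : k = 0 := by simpa [ha] using eq_add_rise_of_run hk
  exact ⟨hk, hb⟩

lemma run_add_of_run (hl : none ∉ l) (H : run h l = some k) (j : ℕ) :
    run (h + j) l = some (k + j) := by
  induction l generalizing h with
  | nil => simpa using H
  | cons c l ih =>
    have hl' : none ∉ l := fun hmem => hl (List.mem_cons_of_mem _ hmem)
    rcases c with _ | _ | _
    · simp at hl
    · rw [run, Nat.add_right_comm]
      exact ih hl' H
    · obtain ⟨i, rfl, Hi⟩ := run_down_cons_eq_some.1 H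
      rw [Nat.add_right_comm, run]
      exact ih hl' Hi

lemma exists_first_descent (H : run (h + 1 + k) l = some m) (hm : m ≤ h) :
    ∃ a b, l = a ++ some .D :: b ∧ none ∉ a ∧ run k a = some 0 ∧ run h b = some m := by
  induction l generalizing k with
  | nil => simp only [run, Option.some.injEq] at H; omega
  | cons c l ih =>
    rcases c with _ | _ | _
    · rw [run_marker_cons_eq_some] at H
      omega
    · obtain ⟨a, b, rfl, ha, hka, hb⟩ := ih (k := k + 1) H
      exact ⟨some .U :: a, b, rfl, by simpa using ha, hka, hb⟩
    · rw [Nat.add_right_comm, run] at H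
      cases k with
      | zero => exact ⟨[], l, rfl, by simp, rfl, H⟩
      | succ k =>
        obtain ⟨a, b, rfl, ha, hka, hb⟩ := ih (k := k) (by rwa [Nat.add_right_comm])
        exact ⟨some .D :: a, b, rfl, by simpa using ha, hka, hb⟩

lemma first_descent_unique (H : a ++ some .D :: b = a' ++ some .D :: b')
    (ha : run 0 a = some 0) (ha' : run 0 a' = some 0) : a = a' := by
  rcases append_cons_eq_append_cons_iff.1 H with ⟨h, -⟩ | ⟨c, rfl, -⟩ | ⟨c, rfl, -⟩
  · exact h
  · simp [run_append, ha'] at ha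
  · simp [run_append, ha] at ha'

lemma exists_last_ascent (hl : none ∉ l) (H : run 0 l = some h) (hj : j < h) :
    ∃ a b, l = a ++ some .U :: b ∧ run 0 a = some j ∧ run 0 b = some (h - j - 1) := by
  induction l using List.reverseRecOn generalizing h with
  | nil => simp only [run, Option.some.injEq] at H; omega
  | append_singleton l c ih =>
    obtain ⟨hl', hc⟩ : none ∉ l ∧ none ≠ c := by simpa [not_or] using hl
    obtain ⟨k, hk, hkc⟩ := run_append_eq_some.1 H
    rcases c with _ | _ | _
    · exact (hc rfl).elim
    · obtain rfl : k + 1 = h := by simpa using hkc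
      rcases (Nat.lt_succ_iff.1 hj).eq_or_lt with rfl | hjk
      · exact ⟨l, [], rfl, hk, by simp⟩
      · obtain ⟨a, b, rfl, ha, hb⟩ := ih hl' hk hjk
        refine ⟨a, b ++ [some .U], by simp, ha, ?_⟩
        simp only [run_append, hb, Option.bind_some, run, Option.some.injEq]
        omega
    · obtain ⟨k, rfl, hkh⟩ := run_down_cons_eq_some.1 hkc
      obtain rfl : k = h := by simpa using hkh
      obtain ⟨a, b, rfl, ha, hb⟩ := ih hl' hk (by omega)
      refine ⟨a, b ++ [some .D], by simp, ha, ?_⟩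
      rw [run_append, hb, show k + 1 - j - 1 = (k - j - 1) + 1 by omega]
      simp

lemma exists_first_minimum (hl : none ∉ l) :
    (∃ h, run 0 l = some h) ∨
      ∃ a b k h, l = a ++ some .D :: b ∧ run k a = some 0 ∧ run 0 b = some h := by
  induction l using List.reverseRecOn with
  | nil => exact .inl ⟨0, rfl⟩
  | append_singleton l c ih =>
    obtain ⟨hl, hc⟩ : none ∉ l ∧ none ≠ c := by simpa [not_or] using hl
    rcases ih hl with ⟨h, H⟩ | ⟨a, b, k, h, rfl, ha, hb⟩
    · rcases c with _ | _ | _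
      · exact (hc rfl).elim
      · exact .inl ⟨h + 1, by simp [run_append, H]⟩
      · cases h with
        | zero => exact .inr ⟨l, [], 0, 0, rfl, H, rfl⟩
        | succ h => exact .inl ⟨h, by simp [run_append, H]⟩
    · rcases c with _ | _ | _
      · exact (hc rfl).elim
      · exact .inr ⟨a, b ++ [some .U], k, h + 1, by simp, ha, by simp [run_append, hb]⟩
      · cases h with
        | zero =>
          have ha' := run_add_of_run (fun hmem => hl (by simp [hmem])) ha 1
          exact .inr ⟨a ++ some .D :: b, [], k + 1, 0, rfl, by simp [run_append, ha', hb], rfl⟩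
        | succ h => exact .inr ⟨a, b ++ [some .D], k, h, by simp, ha, by simp [run_append, hb]⟩

lemma exists_conjugate (hl : none ∉ l) (hrise : rise l = 0) (H : run 0 l ≠ some 0) :
    ∃ a b, l = a ++ some .D :: b ∧ run 0 (b ++ some .D :: a) = some 0 := by
  rcases exists_first_minimum hl with ⟨h, hh⟩ | ⟨a, b, k, h, rfl, ha, hb⟩
  · obtain rfl : h = 0 := by simpa [hrise] using eq_add_rise_of_run hh
    exact (H hh).elim
  · have ha' := eq_add_rise_of_run ha
    have hb' := eq_add_rise_of_run hb
    rw [rise_append, rise_down_cons] at hrise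
    obtain rfl : h = k + 1 := by push_cast at *; omega
    exact ⟨a, b, rfl, by simp [run_append, hb, ha]⟩

lemma run_conjugate_ne (H : run 0 (b ++ some .D :: a) = some 0) :
    run 0 (a ++ some .D :: b) ≠ some 0 := by
  intro H'
  obtain ⟨k, -, hk⟩ := run_append_eq_some.1 H
  obtain ⟨k, rfl, ha⟩ := run_down_cons_eq_some.1 hk
  obtain ⟨j, ha', hj⟩ := run_append_eq_some.1 H'
  obtain ⟨j, rfl, -⟩ := run_down_cons_eq_some.1 hj
  have hk := eq_add_rise_of_run ha
  have hj := eq_add_rise_of_run ha'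
  push_cast at *
  omega

lemma conjugate_unique (E : a ++ some .D :: b = a' ++ some .D :: b')
    (H : run 0 (b ++ some .D :: a) = some 0) (H' : run 0 (b' ++ some .D :: a') = some 0) :
    a = a' := by
  rcases append_cons_eq_append_cons_iff.1 E with ⟨h, -⟩ | ⟨c, rfl, rfl⟩ | ⟨c, rfl, rfl⟩
  · exact h
  · exact (run_conjugate_ne (a := c) (b := b ++ some .D :: a') (by simpa using H)
      (by simpa using H')).elim
  · exact (run_conjugate_ne (a := c) (b := b' ++ some .D :: a) (by simpa using H')
      (by simpa using H)).elim

lemma run_ne_zero_iff_exists_suffix (hl : none ∉ l) (hrise : rise l = 0) :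
    run 0 l ≠ some 0 ↔ ∃ a b, l = a ++ some .U :: b ∧ run 0 b = some 0 := by
  constructor
  · intro H
    obtain ⟨a, b, rfl, hab⟩ := exists_conjugate hl hrise H
    obtain ⟨k, hb, hk⟩ := run_append_eq_some.1 hab
    obtain ⟨k, rfl, -⟩ := run_down_cons_eq_some.1 hk
    obtain ⟨c, d, rfl, -, hd⟩ :=
      exists_last_ascent (fun hmem => hl (by simp [hmem])) hb k.lt_succ_self
    exact ⟨a ++ some .D :: c, d, by simp, by simpa using hd⟩
  · rintro ⟨a, b, rfl, hb⟩ H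
    obtain ⟨k, -, hk⟩ := run_append_eq_some.1 H
    have hup := eq_add_rise_of_run hk
    have hb := eq_add_rise_of_run hb
    simp only [rise_up_cons] at hup
    push_cast at *
    omega

lemma rise_map_some (l : List DyckStep) : rise (l.map some) = (l.count .U : ℤ) - l.count .D := by
  simp only [rise, List.count_map_of_injective _ _ (Option.some_injective _)]

lemma exists_run_map_some_of_forall_take {l : List DyckStep}
    (H : ∀ i, (l.take i).count .D ≤ h + (l.take i).count .U) :
    ∃ k, run h (l.map some) = some k := by
  induction l generalizing h with
  | nil => exact ⟨h, rfl⟩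
  | cons c l ih =>
    have hsucc (i : ℕ) := H (i + 1)
    simp only [List.take_succ_cons, List.count_cons] at hsucc
    cases c with
    | U => exact ih fun i => by have := hsucc i; simp at this; omega
    | D =>
      cases h with
      | zero => simpa using hsucc 0
      | succ h => exact ih fun i => by have := hsucc i; simp at this; omega

lemma run_map_some_eq_zero_iff {l : List DyckStep} :
    run 0 (l.map some) = some 0 ↔ ∃ w : DyckWord, w.toList = l := by
  constructor
  · intro H
    refine ⟨⟨l, ?_, fun i => ?_⟩, rfl⟩
    · have := eq_add_rise_of_run H
      rw [rise_map_some] at this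
      omega
    · rw [← List.take_append_drop i l, List.map_append] at H
      obtain ⟨k, hk, -⟩ := run_append_eq_some.1 H
      have := eq_add_rise_of_run hk
      rw [rise_map_some] at this
      omega
  · rintro ⟨w, rfl⟩
    obtain ⟨k, hk⟩ := exists_run_map_some_of_forall_take (h := 0) fun i => by
      simpa using w.count_D_le_count_U i
    have := eq_add_rise_of_run hk
    rw [rise_map_some, w.count_U_eq_count_D] at this
    rw [hk]
    simpa using this

end MarkedWord

/-! ### Walks around limbs -/

/-- The steps met at a free pearl on the counterclockwise walk: those of `cornerOfFree`, and a
marker at each free `▲`-pearl. -/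
def freeSteps : Pearl → MarkedWord
  | .square => [some .D]
  | .bead .diamond => [some .U]
  | .bead .triangle => [none]
  | .bead .disc => []

/-- The steps met at a pearl that carries an edge. -/
def linkedSteps (x : Pearl) : MarkedWord := (cornerOfLinked x).map some

lemma length_freeSteps_le (x : Pearl) : (freeSteps x).length ≤ 1 := by
  rcases x with _ | _ | _ | _ <;> simp [freeSteps]

lemma linkedSteps_eq_nil_or_singleton (x : Pearl) :
    linkedSteps x = [] ∨ linkedSteps x = [some .U] := by
  rcases x with _ | _ | _ | _ <;> simp [linkedSteps, cornerOfLinked]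

lemma none_notMem_linkedSteps (x : Pearl) : none ∉ linkedSteps x := by simp [linkedSteps]

namespace Limbs

/-- The contour of limbs, with markers at the free `▲`-pearls. -/
def walk : Limbs → MarkedWord
  | nil => []
  | free x rest => rest.walk ++ freeSteps x
  | edge x y sub rest => rest.walk ++ (linkedSteps x ++ sub.walk ++ linkedSteps y)

/-- Juxtaposition of limbs on one vertex. -/
def append : Limbs → Limbs → Limbs
  | nil, M => M
  | free x rest, M => free x (rest.append M)
  | edge x y sub rest, M => edge x y sub (rest.append M)

instance : Append Limbs := ⟨append⟩

@[simp] lemma nil_append (M : Limbs) : nil ++ M = M := rfl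

@[simp] lemma free_append (x : Pearl) (L M : Limbs) : free x L ++ M = free x (L ++ M) := rfl

@[simp] lemma edge_append (x y : Pearl) (S L M : Limbs) :
    edge x y S L ++ M = edge x y S (L ++ M) := rfl

@[simp] lemma append_nil (L : Limbs) : L ++ nil = L := by
  induction L <;> simp_all

lemma append_assoc (L M N : Limbs) : L ++ M ++ N = L ++ (M ++ N) := by
  induction L <;> simp_all

@[simp] lemma row_append (L M : Limbs) : (L ++ M).row = L.row ++ M.row := by
  induction L <;> simp_all [row]

@[simp] lemma walk_append (L M : Limbs) : (L ++ M).walk = M.walk ++ L.walk := by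
  induction L <;> simp_all [walk]

/-- The vertices beyond the current one, as cyclic sequences of pearls. -/
def cycles (L : Limbs) : Multiset (Cycle Pearl) :=
  ↑(L.vertices.map ((↑) : List Pearl → Cycle Pearl))

@[simp] lemma cycles_free (x : Pearl) (L : Limbs) : (free x L).cycles = L.cycles := rfl

@[simp] lemma cycles_edge (x y : Pearl) (S L : Limbs) :
    (edge x y S L).cycles =
      ((y :: S.row : List Pearl) : Cycle Pearl) ::ₘ (S.cycles + L.cycles) := by
  simp [cycles, vertices]

@[simp] lemma cycles_append (L M : Limbs) : (L ++ M).cycles = L.cycles + M.cycles := by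
  induction L with
  | nil => exact (zero_add _).symm
  | free x rest ih => simpa using ih
  | edge x y sub rest _ ih => simp [ih, add_assoc]

/-- All edges satisfy `r` and all free pearls satisfy `p`. -/
def All (r : Pearl → Pearl → Prop) (p : Pearl → Prop) : Limbs → Prop
  | nil => True
  | free x rest => p x ∧ rest.All r p
  | edge x y sub rest => r x y ∧ sub.All r p ∧ rest.All r p

variable {r : Pearl → Pearl → Prop} {p : Pearl → Prop}

lemma all_iff {L : Limbs} : L.All r p ↔ (∀ e ∈ L.edges, r e.1 e.2) ∧ ∀ x ∈ L.frees, p x := by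
  induction L with
  | nil => simp [All, edges, frees]
  | free x rest ih => simp only [All, ih, edges, frees, List.forall_mem_cons]; tauto
  | edge x y sub rest ih₁ ih₂ =>
    simp only [All, ih₁, ih₂, edges, frees, List.forall_mem_cons, List.forall_mem_append]; tauto

lemma all_append {L M : Limbs} : (L ++ M).All r p ↔ L.All r p ∧ M.All r p := by
  induction L <;> simp_all [All, and_assoc]

end Limbs

/-- The vertices of a tree, as cyclic sequences of pearls: this forgets the root. -/
def PearlTree.cycles (τ : PearlTree) : Multiset (Cycle Pearl) :=
  ↑(τ.vertices.map ((↑) : List Pearl → Cycle Pearl))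

lemma PearlTree.cycles_mk (y : Pearl) (L : Limbs) :
    (⟨y, L⟩ : PearlTree).cycles = ((y :: L.row : List Pearl) : Cycle Pearl) ::ₘ L.cycles := rfl

open Limbs

/-- The path from the vertex at the root to a vertex, with what hangs on both sides of it. -/
inductive Spine
  | last (A B : Limbs)
  | step (A : Limbs) (a b : Pearl) (B : Limbs) (s : Spine)

namespace Spine

/-- The limbs with the given spine, `k` telling what hangs at its end. -/
def plug : Spine → (Limbs → Limbs) → Limbs
  | last A B, k => A ++ k B
  | step A a b B s, k => A ++ edge a b (s.plug k) B

/-- The spine with one more edge, followed by what hangs on both sides of its end. -/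
def extend : Spine → Pearl → Pearl → Limbs → Limbs → Spine
  | last A' B', a, b, A, B => step A' a b B' (last A B)
  | step A' a' b' B' s, a, b, A, B => step A' a' b' B' (s.extend a b A B)

/-- The spine seen from its other end. -/
def rev : Spine → Spine
  | last A B => last B A
  | step A a b B s => s.rev.extend b a B A

/-- The part of the walk before the end of the spine. -/
def left : Spine → MarkedWord
  | last _ B => B.walk
  | step _ a _ B s => B.walk ++ linkedSteps a ++ s.left

/-- The part of the walk after the end of the spine. -/
def right : Spine → MarkedWord
  | last A _ => A.walk
  | step A _ b _ s => s.right ++ linkedSteps b ++ A.walk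

lemma plug_extend (s : Spine) (a b : Pearl) (A B : Limbs) (k : Limbs → Limbs) :
    (s.extend a b A B).plug k = s.plug (edge a b (A ++ k B)) := by
  induction s <;> simp_all [extend, plug]

lemma rev_extend (s : Spine) (a b : Pearl) (A B : Limbs) :
    (s.extend a b A B).rev = step B b a A s.rev := by
  induction s <;> simp_all [extend, rev]

@[simp] lemma rev_rev (s : Spine) : s.rev.rev = s := by
  induction s <;> simp_all [rev, rev_extend]

lemma left_extend (s : Spine) (a b : Pearl) (A B : Limbs) :
    (s.extend a b A B).left = s.left ++ linkedSteps a ++ B.walk := by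
  induction s <;> simp_all [extend, left]

@[simp] lemma left_rev (s : Spine) : s.rev.left = s.right := by
  induction s <;> simp_all [rev, left_extend, left, right]

@[simp] lemma right_rev (s : Spine) : s.rev.right = s.left := by
  rw [← left_rev, rev_rev]

lemma walk_plug_free (s : Spine) (x : Pearl) :
    (s.plug (free x)).walk = s.left ++ (freeSteps x ++ s.right) := by
  induction s <;> simp_all [plug, walk, left, right]

/-! ### Rerooting along a spine -/

lemma row_plug_congr (s : Spine) {k k' : Limbs → Limbs} (h : ∀ R, (k R).row = (k' R).row) :
    (s.plug k).row = (s.plug k').row := by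
  cases s <;> simp_all [plug, row]

lemma cycles_plug_edge (s : Spine) (b a : Pearl) (E : Limbs) :
    (s.plug (edge b a E)).cycles = (s.plug (free b)).cycles + (⟨a, E⟩ : PearlTree).cycles := by
  induction s with
  | last A B =>
    simp only [plug, cycles_append, cycles_edge, cycles_free, PearlTree.cycles_mk,
      ← Multiset.singleton_add]
    abel
  | step A a' b' B s ih =>
    simp only [plug, cycles_append, cycles_edge, ih]
    rw [s.row_plug_congr (k := edge b a E) (k' := free b) fun R => rfl]
    simp only [PearlTree.cycles_mk, ← Multiset.singleton_add]
    abel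

lemma _root_.PearlTree.cycles_plug_edge (s : Spine) (x a b : Pearl) (E : Limbs) :
    (⟨x, s.plug (edge b a E)⟩ : PearlTree).cycles =
      (⟨x, s.plug (free b)⟩ : PearlTree).cycles + (⟨a, E⟩ : PearlTree).cycles := by
  rw [PearlTree.cycles_mk, s.cycles_plug_edge,
    s.row_plug_congr (k := edge b a E) (k' := free b) fun R => rfl, ← Multiset.cons_add,
    ← PearlTree.cycles_mk]

lemma _root_.PearlTree.cycles_last_rev (x y : Pearl) (A B : Limbs) :
    (⟨x, B ++ free y A⟩ : PearlTree).cycles = (⟨y, A ++ free x B⟩ : PearlTree).cycles := by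
  have hrot : ((x :: (B.row ++ y :: A.row) : List Pearl) : Cycle Pearl) =
      ((y :: (A.row ++ x :: B.row) : List Pearl) : Cycle Pearl) :=
    Cycle.coe_eq_coe.2 (List.isRotated_append (l := x :: B.row) (l' := y :: A.row))
  simp only [PearlTree.cycles_mk, row_append, row, cycles_append, cycles_free, hrot, add_comm]

lemma _root_.PearlTree.cycles_rev (s : Spine) (x y : Pearl) :
    (⟨x, s.rev.plug (free y)⟩ : PearlTree).cycles = (⟨y, s.plug (free x)⟩ : PearlTree).cycles := by
  induction s generalizing x y with
  | last A B => exact PearlTree.cycles_last_rev x y A B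
  | step A a b B s ih =>
    rw [rev, plug_extend, PearlTree.cycles_plug_edge, ih, PearlTree.cycles_last_rev]
    simpa [plug, add_comm] using
      (PearlTree.cycles_plug_edge (last A B) y b a (s.plug (free x))).symm

variable {r : Pearl → Pearl → Prop} {p : Pearl → Prop}

/-- All edges and free pearls of the limbs on the spine and beside it satisfy `r` and `p`. -/
def All (r : Pearl → Pearl → Prop) (p : Pearl → Prop) : Spine → Prop
  | last A B => A.All r p ∧ B.All r p
  | step A a b B s => A.All r p ∧ B.All r p ∧ r a b ∧ s.All r p

lemma all_plug {s : Spine} {x : Pearl} : (s.plug (free x)).All r p ↔ s.All r p ∧ p x := by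
  induction s with
  | last A B => simp only [plug, all_append, Limbs.All, All]; tauto
  | step A a b B s ih => simp only [plug, all_append, Limbs.All, All, ih]; tauto

lemma all_extend {s : Spine} {a b : Pearl} {A B : Limbs} :
    (s.extend a b A B).All r p ↔ s.All r p ∧ r a b ∧ A.All r p ∧ B.All r p := by
  induction s with
  | last A B => simp only [extend, All]; tauto
  | step A a b B s ih => simp only [extend, All, ih]; tauto

lemma all_rev (hr : ∀ x y, r x y ↔ r y x) {s : Spine} : s.rev.All r p ↔ s.All r p := by
  induction s with
  | last A B => simp only [rev, All]; tauto
  | step A a b B s ih => simp only [rev, all_extend, All, ih, hr a b]; tauto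

/-! ### Free pearls and their places on the walk -/

/-- Juxtaposition of limbs on the left of the first vertex. -/
def prepend (M : Limbs) : Spine → Spine
  | last A B => last (M ++ A) B
  | step A a b B s => step (M ++ A) a b B s

lemma prepend_plug (M : Limbs) (s : Spine) (k : Limbs → Limbs) :
    (s.prepend M).plug k = M ++ s.plug k := by
  cases s <;> simp [prepend, plug, append_assoc]

lemma left_prepend (M : Limbs) (s : Spine) : (s.prepend M).left = s.left := by
  cases s <;> rfl

end Spine

/-- The free pearl met at position `n` of the walk, with its spine. -/
def Limbs.find : Limbs → ℕ → Option (Spine × Pearl)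
  | nil, _ => none
  | free x rest, n =>
    if n < rest.walk.length then (rest.find n).map (Prod.map (Spine.prepend (free x nil)) id)
    else some (.last nil rest, x)
  | edge x y sub rest, n =>
    if n < rest.walk.length then
      (rest.find n).map (Prod.map (Spine.prepend (edge x y sub nil)) id)
    else (sub.find (n - rest.walk.length - (linkedSteps x).length)).map
      (Prod.map (Spine.step nil x y rest) id)

namespace Spine

lemma find_append {M L : Limbs} {n : ℕ} {s : Spine} {x : Pearl} (hn : n < L.walk.length)
    (h : L.find n = some (s, x)) : (M ++ L).find n = some (s.prepend M, x) := by
  induction M with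
  | nil => cases s <;> exact h
  | free z M ih =>
    rw [free_append, find, if_pos (by simp; omega), ih]
    cases s <;> rfl
  | edge z z' S M _ ih =>
    rw [edge_append, find, if_pos (by simp; omega), ih]
    cases s <;> rfl

lemma find_plug (s : Spine) {x : Pearl} (hx : freeSteps x ≠ []) :
    (s.plug (free x)).find s.left.length = some (s, x) := by
  have hpos := List.length_pos_iff.2 hx
  induction s with
  | last A B =>
    have hfind : (free x B).find B.walk.length = some (.last nil B, x) := by simp [find]
    simpa [plug, left, prepend] using find_append (M := A) (by simp [walk]; omega) hfind
  | step A a b B s ih =>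
    have hlen : (step A a b B s).left.length - B.walk.length - (linkedSteps a).length =
        s.left.length := by simp [left]
    have hfind : (edge a b (s.plug (free x)) B).find (step A a b B s).left.length =
        some (.step nil a b B s, x) := by
      rw [find, if_neg (by simp [left]), hlen, ih]
      rfl
    simpa [plug, prepend] using
      find_append (M := A) (by simp [walk, walk_plug_free, left]; omega) hfind

lemma plug_inj {s s' : Spine} {x x' : Pearl} (hx : freeSteps x ≠ []) (hx' : freeSteps x' ≠ [])
    (h : s.plug (free x) = s'.plug (free x')) (hl : s.left.length = s'.left.length) :
    s = s' ∧ x = x' := by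
  have hfind := find_plug s hx
  rw [h, hl, find_plug s' hx', Option.some.injEq, Prod.mk.injEq] at hfind
  exact ⟨hfind.1.symm, hfind.2.symm⟩

variable {l r : MarkedWord} {d : Option DyckStep}

lemma notMem_linkedSteps (hd : d ≠ some .U) (x : Pearl) : d ∉ linkedSteps x := by
  rcases linkedSteps_eq_nil_or_singleton x with h | h <;> simp [h, hd]

lemma eq_singleton_of_freeSteps {x : Pearl} (h : freeSteps x = l ++ d :: r) :
    freeSteps x = [d] ∧ l = [] := by
  have hlen := length_freeSteps_le x
  obtain ⟨rfl, rfl⟩ : l = [] ∧ r = [] := by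
    rw [h, List.length_append, List.length_cons] at hlen
    exact ⟨List.length_eq_zero_iff.1 (by omega), List.length_eq_zero_iff.1 (by omega)⟩
  exact ⟨h, rfl⟩

lemma exists_plug_left {L : Limbs} (hd : d ≠ some .U) (h : L.walk = l ++ d :: r) :
    ∃ (s : Spine) (x : Pearl), L = s.plug (free x) ∧ freeSteps x = [d] ∧ s.left = l := by
  induction L generalizing l r with
  | nil => simp [walk] at h
  | free z rest ih =>
    rcases append_eq_append_cons_iff.1 h with ⟨r', hrest, -⟩ | ⟨l', rfl, hz⟩
    · obtain ⟨s, x, rfl, hx, hs⟩ := ih hrest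
      exact ⟨s.prepend (free z nil), x, by simp [prepend_plug], hx, by rw [left_prepend, hs]⟩
    · obtain ⟨hz', rfl⟩ := eq_singleton_of_freeSteps hz
      exact ⟨.last nil rest, z, rfl, hz', by simp [left]⟩
  | edge z z' S rest ihS ih =>
    rcases append_eq_append_cons_iff.1 h with ⟨r', hrest, -⟩ | ⟨l', rfl, hedge⟩
    · obtain ⟨s, x, rfl, hx, hs⟩ := ih hrest
      exact ⟨s.prepend (edge z z' S nil), x, by simp [prepend_plug], hx, by rw [left_prepend, hs]⟩
    · rcases append_eq_append_cons_iff.1 hedge with ⟨r', hzS, -⟩ | ⟨_, -, hz'⟩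
      · rcases append_eq_append_cons_iff.1 hzS with ⟨_, hz, -⟩ | ⟨l'', rfl, hS⟩
        · exact (notMem_linkedSteps hd z (by simp [hz])).elim
        · obtain ⟨s, x, rfl, hx, hs⟩ := ihS hS
          exact ⟨.step nil z z' rest s, x, rfl, hx, by simp [left, hs]⟩
      · exact (notMem_linkedSteps hd z' (by simp [hz'])).elim

lemma exists_plug {L : Limbs} (hd : d ≠ some .U) (h : L.walk = l ++ d :: r) :
    ∃ (s : Spine) (x : Pearl), L = s.plug (free x) ∧ freeSteps x = [d] ∧ s.left = l ∧
      s.right = r := by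
  obtain ⟨s, x, rfl, hx, rfl⟩ := exists_plug_left hd h
  exact ⟨s, x, rfl, hx, rfl, by simpa [walk_plug_free, hx] using h⟩

end Spine

/-! ### Rewiring non-negative trees into balanced companion trees -/

namespace Limbs

lemma coe_pearls (L : Limbs) :
    (L.pearls : Multiset Pearl) = ↑L.row + (L.cycles.map Cycle.toMultiset).sum := by
  induction L with
  | nil => rfl
  | free x rest ih =>
    simp only [pearls, row, cycles_free, ← Multiset.cons_coe, ih, Multiset.cons_add]
  | edge x y S rest ihS ih =>
    simp only [pearls, row, cycles_edge, ← Multiset.cons_coe, ← Multiset.coe_add, ihS, ih,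
      Multiset.map_cons, Multiset.sum_cons, Multiset.map_add, Multiset.sum_add,
      Cycle.coe_toMultiset]
    simp only [← Multiset.singleton_add]
    abel

end Limbs

lemma PearlTree.coe_pearls (τ : PearlTree) :
    (τ.pearls : Multiset Pearl) = (τ.cycles.map Cycle.toMultiset).sum := by
  obtain ⟨y, L⟩ := τ
  simp only [PearlTree.pearls, PearlTree.cycles_mk, Multiset.map_cons, Multiset.sum_cons,
    Cycle.coe_toMultiset, ← Multiset.cons_coe, Limbs.coe_pearls, Multiset.cons_add]

lemma PearlTree.pearls_perm_of_cycles_eq {τ τ' : PearlTree} (h : τ.cycles = τ'.cycles) :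
    τ.pearls.Perm τ'.pearls := by
  rw [← Multiset.coe_eq_coe, τ.coe_pearls, τ'.coe_pearls, h]

/-- The pairs of pearls that edges of `Q`-trees may join. -/
def QEdge (x y : Pearl) : Prop := Joins .disc .square x y ∨ Joins .diamond .square x y

/-- The pairs of pearls that edges of companion trees may join. -/
def CEdge (x y : Pearl) : Prop := Joins .disc .square x y ∨ Joins .diamond .triangle x y

/-- The pearls that may be free in companion trees. -/
def CFree (x : Pearl) : Prop := x ≠ .disc ∧ x ≠ .diamond

lemma CEdge.comm (x y : Pearl) : CEdge x y ↔ CEdge y x := by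
  unfold CEdge Joins; tauto

/-- Each cyclic sequence has exactly one `□`-pearl. -/
def OneSquare (m : Multiset (Cycle Pearl)) : Prop :=
  ∀ c ∈ m, c.toMultiset.count .square = 1

lemma oneSquare_cons {l : List Pearl} {m : Multiset (Cycle Pearl)} :
    OneSquare ((l : Cycle Pearl) ::ₘ m) ↔ l.count .square = 1 ∧ OneSquare m := by
  simp [OneSquare]

lemma oneSquare_cycles_mk {y : Pearl} {L : Limbs} :
    OneSquare (⟨y, L⟩ : PearlTree).cycles ↔
      (y :: L.row).count .square = 1 ∧ OneSquare L.cycles := by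
  rw [PearlTree.cycles_mk, oneSquare_cons]

lemma oneSquare_cycles_edge {x y : Pearl} {S L : Limbs} :
    OneSquare (edge x y S L).cycles ↔
      OneSquare (⟨y, S⟩ : PearlTree).cycles ∧ OneSquare L.cycles := by
  simp only [cycles_edge, oneSquare_cons, oneSquare_cycles_mk, and_assoc]
  simp only [OneSquare, Multiset.mem_add, or_imp, forall_and]

lemma oneSquare_square_cycles {L : Limbs} :
    OneSquare (⟨.square, L⟩ : PearlTree).cycles ↔ .square ∉ L.row ∧ OneSquare L.cycles := by
  simp [oneSquare_cycles_mk, List.count_eq_zero]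

lemma oneSquare_square_free {x : Pearl} {L : Limbs} :
    OneSquare (⟨.square, free x L⟩ : PearlTree).cycles ↔
      x ≠ .square ∧ OneSquare (⟨.square, L⟩ : PearlTree).cycles := by
  simp [oneSquare_square_cycles, row, and_assoc, eq_comm]

lemma oneSquare_square_edge {x y : Pearl} {S L : Limbs} :
    OneSquare (⟨.square, edge x y S L⟩ : PearlTree).cycles ↔
      x ≠ .square ∧ OneSquare (⟨y, S⟩ : PearlTree).cycles ∧
        OneSquare (⟨.square, L⟩ : PearlTree).cycles := by
  simp only [oneSquare_square_cycles, oneSquare_cycles_edge, row, List.mem_cons, not_or, ne_eq,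
    eq_comm (a := Pearl.square)]
  tauto

lemma Limbs.rise_walk {L : Limbs} (h : L.All CEdge CFree) (hL : OneSquare L.cycles) :
    MarkedWord.rise L.walk = -(L.row.count .square : ℤ) := by
  induction L with
  | nil => rfl
  | free x rest ih =>
    have hrest := ih h.2 hL
    rcases x with _ | _ | _ | _
    · simp [walk, row, freeSteps, hrest]; ring
    · exact (h.1.1 rfl).elim
    · exact (h.1.2 rfl).elim
    · simpa [walk, row, freeSteps] using hrest
  | edge x y S rest ihS ih =>
    rw [oneSquare_cycles_edge, oneSquare_cycles_mk] at hL
    have hS := ihS h.2.1 hL.1.2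
    have hrest := ih h.2.2 hL.2
    have hy := hL.1.1
    rcases h.1 with (⟨rfl, rfl⟩ | ⟨rfl, rfl⟩) | (⟨rfl, rfl⟩ | ⟨rfl, rfl⟩) <;>
      simp_all [walk, row, linkedSteps, cornerOfLinked]
    ring

lemma rise_walk_eq_zero {L : Limbs} (h : L.All CEdge CFree)
    (hL : OneSquare (⟨.square, L⟩ : PearlTree).cycles) : MarkedWord.rise L.walk = 0 := by
  rw [oneSquare_square_cycles] at hL
  rw [rise_walk h hL.2, List.count_eq_zero.2 hL.1, Nat.cast_zero, neg_zero]

lemma rise_walk_eq_neg_one {y : Pearl} {L : Limbs} (hy : y ≠ .square) (h : L.All CEdge CFree)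
    (hL : OneSquare (⟨y, L⟩ : PearlTree).cycles) : MarkedWord.rise L.walk = -1 := by
  rw [oneSquare_cycles_mk, List.count_cons_of_ne hy] at hL
  rw [rise_walk h hL.2, hL.1, Nat.cast_one]

@[simp] lemma excess_nil : excess [] = 0 := rfl

@[simp] lemma excess_append (a b : List Pearl) : excess (a ++ b) = excess a + excess b := by
  simp only [excess, List.count_append]; push_cast; ring

@[simp] lemma excess_square_cons (l : List Pearl) : excess (.square :: l) = excess l := by
  simp [excess]

@[simp] lemma excess_disc_cons (l : List Pearl) : excess (.disc :: l) = excess l := by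
  simp [excess]

@[simp] lemma excess_diamond_cons (l : List Pearl) : excess (.diamond :: l) = excess l - 1 := by
  simp [excess]; ring

@[simp] lemma excess_triangle_cons (l : List Pearl) : excess (.triangle :: l) = excess l + 1 := by
  simp [excess]; ring

lemma freeSteps_eq_down {x : Pearl} : freeSteps x = [some .D] ↔ x = .square := by
  rcases x with _ | _ | _ | _ <;> simp [freeSteps]

lemma freeSteps_eq_marker {x : Pearl} : freeSteps x = [none] ↔ x = .triangle := by
  rcases x with _ | _ | _ | _ <;> simp [freeSteps]

/-- `Rewire L L'`: the limbs `L'` of a companion tree are obtained from the limbs `L` of a `Q`-tree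
by linking each `♦`-pearl to the last free `▲`-pearl on the walk around the subtree that hangs at
it, instead of the `□`-pearl of that subtree, from the leaves towards the root. -/
inductive Rewire : Limbs → Limbs → Prop
  | nil : Rewire nil nil
  | free {L L'} : Rewire L L' → Rewire (free .triangle L) (free .triangle L')
  | disc {S S' L L'} : Rewire S S' → Rewire L L' →
      Rewire (edge .disc .square S L) (edge .disc .square S' L')
  | diamond {S S' R L L'} (s : Spine) : Rewire S S' → S' = s.plug (Limbs.free .triangle) →
      none ∉ s.right → R = s.rev.plug (Limbs.free .square) → Rewire L L' →
      Rewire (edge .diamond .square S L) (edge .diamond .triangle R L')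

namespace Rewire

open MarkedWord

variable {L L' M : Limbs}

lemma row_eq (h : Rewire L L') : L'.row = L.row := by
  induction h <;> simp_all [row]

lemma cycles_eq (h : Rewire L L') : L'.cycles = L.cycles := by
  induction h with
  | nil => rfl
  | free _ ih => simpa using ih
  | disc hS _ ihS ih => simp [ihS, ih, hS.row_eq]
  | diamond s hS hs _ hR _ ihS ih =>
    subst hs hR
    have hrev := PearlTree.cycles_rev s .triangle .square
    rw [PearlTree.cycles_mk, PearlTree.cycles_mk] at hrev
    rw [cycles_edge, cycles_edge, ← Multiset.cons_add, hrev, hS.row_eq, ihS, ih, Multiset.cons_add]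

lemma tree_cycles_eq (h : Rewire L L') (y : Pearl) :
    (⟨y, L'⟩ : PearlTree).cycles = (⟨y, L⟩ : PearlTree).cycles := by
  rw [PearlTree.cycles_mk, h.row_eq, h.cycles_eq, PearlTree.cycles_mk]

lemma all_left (h : Rewire L L') : L.All QEdge (· = .triangle) := by
  induction h <;> simp_all [Limbs.All, QEdge, Joins]

lemma all_right (h : Rewire L L') : L'.All CEdge CFree := by
  induction h with
  | nil => trivial
  | free _ ih => exact ⟨by simp [CFree], ih⟩
  | disc _ _ ihS ih => exact ⟨by simp [CEdge, Joins], ihS, ih⟩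
  | diamond s _ hs _ hR _ ihS ih =>
    subst hs hR
    rw [Spine.all_plug] at ihS
    refine ⟨by simp [CEdge, Joins], ?_, ih⟩
    rw [Spine.all_plug, Spine.all_rev CEdge.comm]
    exact ⟨ihS.1, by simp [CFree]⟩

lemma run_walk (h : Rewire L L') : run 0 L'.walk = some 0 := by
  induction h with
  | nil => rfl
  | free _ ih => simp [walk, freeSteps, run_append, ih]
  | disc _ _ ihS ih => simp [walk, linkedSteps, cornerOfLinked, run_append, ihS, ih]
  | diamond s _ hs hn hR _ ihS ih =>
    subst hs hR
    rw [Spine.walk_plug_free] at ihS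
    obtain ⟨k, hleft, hk⟩ := run_append_eq_some.1 ihS
    obtain ⟨rfl, hright⟩ := run_marker_cons_eq_some.1 hk
    have hright' := run_add_of_run hn hright 1
    rw [Nat.zero_add] at hright'
    simp [walk, linkedSteps, cornerOfLinked, run_append, ih, Spine.walk_plug_free, hright',
      freeSteps, hleft]

lemma count_none_walk (h : Rewire L L') : (L'.walk.count none : ℤ) = excess L.pearls := by
  have hlinked (x : Pearl) : (linkedSteps x).count none = 0 :=
    List.count_eq_zero.2 (none_notMem_linkedSteps x)
  induction h with
  | nil => rfl
  | free _ ih => simp [pearls, walk, freeSteps, ← ih]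
  | disc _ _ ihS ih => simp [pearls, walk, hlinked, ← ihS, ← ih, add_comm]
  | diamond s _ hs _ hR _ ihS ih =>
    subst hs hR
    simp only [Spine.walk_plug_free, freeSteps] at ihS
    simp [pearls, walk, hlinked, Spine.walk_plug_free, freeSteps, ← ihS, ← ih]
    ring

lemma nonNeg (h : Rewire L L') : L.NonNeg := by
  induction h with
  | nil => trivial
  | free _ ih => exact ⟨by simp, ih⟩
  | disc hS _ ihS ih =>
    refine ⟨?_, ?_, ihS, ih⟩ <;> simp [← hS.count_none_walk]
  | diamond s hS hs _ _ _ ihS ih =>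
    subst hs
    refine ⟨?_, ?_, ihS, ih⟩ <;> simp [← hS.count_none_walk, Spine.walk_plug_free, freeSteps] <;>
      omega

lemma right_unique (h : Rewire L L') (h' : Rewire L M) : L' = M := by
  induction h generalizing M with
  | nil => cases h'; rfl
  | free _ ih => cases h' with | free h' => rw [ih h']
  | disc _ _ ihS ih => cases h' with | disc hS' h' => rw [ihS hS', ih h']
  | diamond s _ hs hn hR _ ihS ih =>
    cases h' with
    | diamond t hS' ht hm hR' h' =>
      have hst := ihS hS'
      subst hs hR hR' ht
      have hleft : s.left = t.left := by
        have hwalk := congrArg walk hst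
        simp only [Spine.walk_plug_free, freeSteps, List.singleton_append] at hwalk
        rcases append_cons_eq_append_cons_iff.1 hwalk with
          ⟨hleft, -⟩ | ⟨c, -, hright⟩ | ⟨c, -, hright⟩
        · exact hleft
        · simp [hright] at hm
        · simp [hright] at hn
      obtain ⟨rfl, -⟩ := Spine.plug_inj (by simp [freeSteps]) (by simp [freeSteps]) hst
        (by rw [hleft])
      rw [ih h']

lemma left_unique (h : Rewire L L') (h' : Rewire M L') : L = M := by
  induction h generalizing M with
  | nil => cases h'; rfl
  | free _ ih => cases h' with | free h' => rw [ih h']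
  | disc _ _ ihS ih => cases h' with | disc hS' h' => rw [ihS hS', ih h']
  | diamond s hS hs _ hR _ ihS ih =>
    cases h' with
    | diamond t hS' ht _ hR' h' =>
      subst hs hR ht
      have hs := hS.run_walk
      have ht := hS'.run_walk
      have hwalk := congrArg walk hR'
      simp only [Spine.walk_plug_free, Spine.left_rev, Spine.right_rev, freeSteps,
        List.singleton_append] at hwalk hs ht
      have hright : s.right = t.right := by
        obtain ⟨k, -, hs⟩ := run_append_eq_some.1 hs
        obtain ⟨k, -, ht⟩ := run_append_eq_some.1 ht
        exact first_descent_unique hwalk (run_marker_cons_eq_some.1 hs).2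
          (run_marker_cons_eq_some.1 ht).2
      obtain ⟨hrev, -⟩ := Spine.plug_inj (by simp [freeSteps]) (by simp [freeSteps]) hR'
        (by simp [hright])
      obtain rfl : s = t := by rw [← s.rev_rev, hrev, t.rev_rev]
      rw [ihS hS', ih h']

lemma exists_last_triangle {S : Limbs} (h : none ∈ S.walk) :
    ∃ s : Spine, S = s.plug (Limbs.free .triangle) ∧ none ∉ s.right := by
  obtain ⟨r, l, hrev, hr⟩ := List.eq_append_cons_of_mem (List.mem_reverse.2 h)
  rw [List.reverse_eq_iff, List.reverse_append, List.reverse_cons, List.append_assoc] at hrev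
  obtain ⟨s, x, hs, hx, -, hright⟩ := Spine.exists_plug (by simp) hrev
  obtain rfl := freeSteps_eq_marker.1 hx
  exact ⟨s, hs, by simpa [hright] using hr⟩

theorem exists_right (h : L.All QEdge (· = .triangle))
    (hL : OneSquare (⟨.square, L⟩ : PearlTree).cycles) (hnn : L.NonNeg) : ∃ L', Rewire L L' := by
  induction L with
  | nil => exact ⟨_, .nil⟩
  | free x rest ih =>
    obtain ⟨rfl, h⟩ := h
    obtain ⟨L', hL'⟩ := ih h (oneSquare_square_free.1 hL).2 hnn.2
    exact ⟨_, .free hL'⟩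
  | edge x y S rest ihS ih =>
    obtain ⟨hx, hS, hrest⟩ := oneSquare_square_edge.1 hL
    obtain ⟨L', hL'⟩ := ih h.2.2 hrest hnn.2.2.2
    obtain rfl : y = .square := by
      rcases h.1 with (⟨-, hy⟩ | ⟨hx', -⟩) | (⟨-, hy⟩ | ⟨hx', -⟩)
      exacts [hy, (hx hx').elim, hy, (hx hx').elim]
    obtain ⟨S', hS'⟩ := ihS h.2.1 hS hnn.2.2.1
    rcases h.1 with (⟨rfl, -⟩ | ⟨rfl, -⟩) | (⟨rfl, -⟩ | ⟨rfl, -⟩)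
    · exact ⟨_, .disc hS' hL'⟩
    · exact (hx rfl).elim
    · have hexcess : 1 ≤ excess S.pearls := by simpa using hnn.1
      obtain ⟨s, hs, hn⟩ := exists_last_triangle (S := S') <| by
        rw [← hS'.count_none_walk] at hexcess
        exact List.count_pos_iff.1 (by omega)
      exact ⟨_, .diamond s hS' hs hn rfl hL'⟩
    · exact (hx rfl).elim

lemma exists_first_square {S : Limbs} (h : S.All CEdge CFree)
    (hS : OneSquare (⟨.triangle, S⟩ : PearlTree).cycles) (hrun : run 1 S.walk = some 0) :
    ∃ t : Spine, S = t.plug (Limbs.free .square) ∧ none ∉ t.left ∧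
      (t.rev.plug (Limbs.free .triangle)).All CEdge CFree ∧
      OneSquare (⟨.square, t.rev.plug (Limbs.free .triangle)⟩ : PearlTree).cycles ∧
      run 0 (t.rev.plug (Limbs.free .triangle)).walk = some 0 := by
  obtain ⟨a, b, hwalk, ha, hrun_a, hrun_b⟩ := exists_first_descent (h := 0) (k := 0) hrun le_rfl
  obtain ⟨t, x, rfl, hx, rfl, rfl⟩ := Spine.exists_plug (by simp) hwalk
  obtain rfl := freeSteps_eq_down.1 hx
  refine ⟨t, rfl, ha, ?_, by rwa [PearlTree.cycles_rev], ?_⟩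
  · rw [Spine.all_plug] at h
    rw [Spine.all_plug, Spine.all_rev CEdge.comm]
    exact ⟨h.1, by simp [CFree]⟩
  · simp [Spine.walk_plug_free, run_append, freeSteps, hrun_a, hrun_b]

lemma length_pearls_rev (t : Spine) (x y : Pearl) :
    (t.rev.plug (Limbs.free y)).pearls.length = (t.plug (Limbs.free x)).pearls.length := by
  simpa [PearlTree.pearls] using
    (PearlTree.pearls_perm_of_cycles_eq (PearlTree.cycles_rev t x y)).length_eq

theorem exists_left (h : L'.All CEdge CFree) (hL' : OneSquare (⟨.square, L'⟩ : PearlTree).cycles)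
    (hrun : run 0 L'.walk = some 0) : ∃ L, Rewire L L' := by
  induction hn : L'.pearls.length using Nat.strong_induction_on generalizing L' with
  | _ n ih =>
  subst hn
  cases L' with
  | nil => exact ⟨_, .nil⟩
  | free x rest =>
    obtain ⟨hx, hrest⟩ := oneSquare_square_free.1 hL'
    obtain ⟨hrun, -⟩ := run_append_eq_zero_of_rise_eq_zero hrun (rise_walk_eq_zero h.2 hrest)
    obtain ⟨L, hL⟩ := ih _ (by simp [pearls]) h.2 hrest hrun rfl
    rcases x with _ | _ | _ | _
    exacts [(hx rfl).elim, (h.1.1 rfl).elim, (h.1.2 rfl).elim, ⟨_, .free hL⟩]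
  | edge x y S rest =>
    obtain ⟨hx, hS, hrest⟩ := oneSquare_square_edge.1 hL'
    obtain ⟨hrun, hrunS⟩ :=
      run_append_eq_zero_of_rise_eq_zero hrun (rise_walk_eq_zero h.2.2 hrest)
    obtain ⟨L, hL⟩ := ih _ (by simp [pearls]; omega) h.2.2 hrest hrun rfl
    rcases h.1 with (⟨rfl, rfl⟩ | ⟨rfl, -⟩) | (⟨rfl, rfl⟩ | ⟨rfl, rfl⟩)
    · obtain ⟨M, hM⟩ := ih _ (by simp [pearls]; omega) h.2.1 hS
        (by simpa [linkedSteps, cornerOfLinked] using hrunS) rfl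
      exact ⟨_, .disc hM hL⟩
    · exact (hx rfl).elim
    · obtain ⟨t, rfl, hleft, ht, htS, hrun_t⟩ := exists_first_square h.2.1 hS
        (by simpa [linkedSteps, cornerOfLinked] using hrunS)
      obtain ⟨M, hM⟩ := ih _ (by rw [length_pearls_rev t .square]; simp [pearls]; omega)
        ht htS hrun_t rfl
      exact ⟨_, .diamond t.rev hM rfl (by simpa using hleft) (by simp) hL⟩
    · obtain ⟨k, hk, -⟩ := run_append_eq_some.1 hrunS
      have hrise := eq_add_rise_of_run hk
      rw [rise_append, rise_walk_eq_neg_one (by simp) h.2.1 hS] at hrise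
      simp [linkedSteps, cornerOfLinked] at hrise

end Rewire

/-! ### The classes of trees -/

lemma necklaceWord_append_square_cons {A : List Pearl} (B : List Pearl) (hA : .square ∉ A) :
    necklaceWord (A ++ .square :: B) = (B ++ A).filterMap Pearl.bead? := by
  rw [necklaceWord, List.idxOf_append_of_notMem hA, List.idxOf_cons_self, Nat.add_zero,
    List.rotate_append_length_eq]
  rfl

lemma necklaceWord_append_comm {a b : List Pearl} (ha : .square ∉ a) (hb : .square ∈ b) :
    necklaceWord (b ++ a) = necklaceWord (a ++ b) := by
  obtain ⟨A, B, rfl, hA⟩ := List.eq_append_cons_of_mem hb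
  rw [List.append_assoc, List.cons_append, necklaceWord_append_square_cons _ hA,
    ← List.append_assoc, necklaceWord_append_square_cons _ (by simp [ha, hA]), List.append_assoc]

lemma necklaceWord_isRotated {l l' : List Pearl} (h : l.count .square = 1) (hl : l ~r l') :
    necklaceWord l' = necklaceWord l := by
  obtain ⟨n, hn, rfl⟩ := List.isRotated_iff_mod.1 hl
  rw [← List.take_append_drop n l, List.count_append] at h
  rw [List.rotate_eq_drop_append_take hn]
  conv_rhs => rw [← List.take_append_drop n l]
  by_cases hmem : .square ∈ l.take n
  · have := List.count_pos_iff.2 hmem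
    exact (necklaceWord_append_comm (List.count_eq_zero.1 (by omega)) hmem).symm
  · rw [List.count_eq_zero.2 hmem, zero_add] at h
    exact necklaceWord_append_comm hmem (List.count_pos_iff.1 (by omega))

lemma necklaceWord_out {l : List Pearl} (h : l.count .square = 1) :
    necklaceWord (l : Cycle Pearl).out = necklaceWord l :=
  necklaceWord_isRotated h (Cycle.coe_eq_coe.1 (Quotient.out_eq (l : Cycle Pearl))).symm

namespace PearlTree

variable {Q : Set (List Bead)} {τ τ' : PearlTree}

lemma cycles_eq_map_vertices (τ : PearlTree) :
    τ.cycles = (τ.vertices : Multiset (List Pearl)).map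
      fun c : List Pearl => (c : Cycle Pearl) := rfl

lemma size_eq_card_cycles (τ : PearlTree) : τ.size = τ.cycles.card := by
  rw [cycles_eq_map_vertices, Multiset.card_map, Multiset.coe_card, size]

lemma hasNecklacesIn_iff_forall_cycles : τ.HasNecklacesIn Q ↔
    ∀ c ∈ τ.cycles, c.toMultiset.count .square = 1 ∧ necklaceWord c.out ∈ Q := by
  simp only [HasNecklacesIn, cycles_eq_map_vertices, Multiset.mem_map, Multiset.mem_coe,
    forall_exists_index, and_imp, forall_apply_eq_imp_iff₂, Cycle.coe_toMultiset,
    Multiset.coe_count]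
  exact forall₂_congr fun l _ => and_congr_right fun h => by rw [necklaceWord_out h]

lemma HasNecklacesIn.oneSquare (h : τ.HasNecklacesIn Q) : OneSquare τ.cycles :=
  fun c hc => (hasNecklacesIn_iff_forall_cycles.1 h c hc).1

lemma HasNecklacesIn.congr (h : τ.HasNecklacesIn Q) (hcycles : τ'.cycles = τ.cycles) :
    τ'.HasNecklacesIn Q := by
  rwa [hasNecklacesIn_iff_forall_cycles, hcycles, ← hasNecklacesIn_iff_forall_cycles]

lemma HasNecklacesIn.necklaces_eq (h : τ.HasNecklacesIn Q) :
    τ.necklaces = τ.cycles.map fun c => necklaceWord c.out := by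
  rw [cycles_eq_map_vertices, Multiset.map_map, necklaces, ← Multiset.map_coe]
  exact Multiset.map_congr rfl fun l hl => (necklaceWord_out (h l hl).1).symm

lemma HasNecklacesIn.necklaces_congr (h : τ.HasNecklacesIn Q) (hcycles : τ'.cycles = τ.cycles) :
    τ'.necklaces = τ.necklaces := by
  rw [h.necklaces_eq, (h.congr hcycles).necklaces_eq, hcycles]

lemma ext_of_root_eq {x : Pearl} (h : τ.root = x) (h' : τ'.root = x) (hlimbs : τ.limbs = τ'.limbs) :
    τ = τ' := by
  obtain ⟨y, L⟩ := τ
  obtain ⟨y', L'⟩ := τ'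
  rw [PearlTree.mk.injEq]
  exact ⟨h.trans h'.symm, hlimbs⟩

end PearlTree

namespace Limbs

variable {r : Pearl → Pearl → Prop} {L : Limbs}

lemma none_mem_walk_iff : none ∈ L.walk ↔ .triangle ∈ L.frees := by
  induction L with
  | nil => simp [walk, frees]
  | free x rest ih =>
    rcases x with _ | _ | _ | _ <;> simp [walk, frees, freeSteps, ih]
  | edge x y S rest ihS ih =>
    simp [walk, frees, none_notMem_linkedSteps, ihS, ih, or_comm]

lemma all_cFree_of_all_square (h : L.All r (· = .square)) : L.All r CFree := by
  rw [all_iff] at h ⊢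
  exact ⟨h.1, fun x hx => by simp [h.2 x hx, CFree]⟩

lemma none_notMem_walk (h : L.All r (· = .square)) : none ∉ L.walk := fun hnone => by
  simpa using (all_iff.1 h).2 _ (none_mem_walk_iff.1 hnone)

lemma walk_eq_contour (h : L.All r (· = .square)) : L.walk = L.contour.map some := by
  induction L with
  | nil => rfl
  | free x rest ih =>
    obtain ⟨rfl, h⟩ := h
    simp [walk, contour, ih h, freeSteps, cornerOfFree]
  | edge x y S rest ihS ih =>
    simp [walk, contour, ihS h.2.1, ih h.2.2, linkedSteps]

lemma count_up_walk (h : L.All r (· = .square)) :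
    L.walk.count (some .U) = L.pearls.count .diamond := by
  have hlinked : ∀ x, (linkedSteps x).count (some .U) = [x].count .diamond := by
    rintro (_ | _ | _ | _) <;> decide
  induction L with
  | nil => rfl
  | free x rest ih =>
    obtain ⟨rfl, h⟩ := h
    simp [walk, pearls, ih h, freeSteps]
  | edge x y S rest ihS ih =>
    simp only [walk, pearls, List.count_append, hlinked, ihS h.2.1, ih h.2.2, List.count_cons,
      List.count_nil]
    omega

end Limbs

open MarkedWord

lemma closureMatches_cons_zero {w : List DyckStep} {i : ℕ} :
    ClosureMatches (.D :: w) i 0 ↔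
      ∃ (v : List DyckStep) (m : DyckWord), w = v ++ .U :: m.toList ∧ i = v.length + 1 := by
  constructor
  · rintro ⟨hi, m, r, hrot, hmod⟩
    have hlength := congrArg List.length hrot
    simp only [List.length_rotate, List.length_cons, List.length_append] at hi hlength hmod
    have hi_add : i + m.toList.length + 1 = w.length + 1 :=
      Nat.eq_of_dvd_of_lt_two_mul (by omega) (Nat.dvd_of_mod_eq_zero hmod.symm) (by omega)
    rw [List.rotate_eq_drop_append_take (by simp; omega), ← List.cons_append] at hrot
    have hdrop := List.append_inj_left hrot (by simp; omega)
    obtain _ | i := i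
    · simp at hdrop
    · rw [List.drop_succ_cons] at hdrop
      exact ⟨w.take i, m, by rw [← hdrop, List.take_append_drop], by simp; omega⟩
  · rintro ⟨v, m, rfl, rfl⟩
    refine ⟨by simp, m, v, ?_, ?_⟩
    · rw [← List.cons_append, ← List.length_cons (a := DyckStep.D), List.rotate_append_length_eq,
        List.cons_append]
    · rw [List.length_cons, List.length_append, List.length_cons, Nat.add_right_comm v.length,
        Nat.add_assoc v.length, Nat.add_right_comm, Nat.mod_self]

lemma forall_not_closureMatches_iff {w : List DyckStep} (hrise : rise (w.map some) = 0) :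
    (∀ i, ¬ ClosureMatches (.D :: w) i 0) ↔ run 0 (w.map some) = some 0 := by
  rw [← not_exists, not_iff_comm, ← ne_eq, run_ne_zero_iff_exists_suffix (by simp) hrise]
  simp only [closureMatches_cons_zero]
  constructor
  · rintro ⟨a, b, hw, hb⟩
    obtain ⟨v, u, rfl, rfl, hu⟩ := List.map_eq_append_iff.1 hw
    obtain ⟨d, m, rfl, hd, rfl⟩ := List.map_eq_cons_iff.1 hu
    obtain ⟨m, rfl⟩ := run_map_some_eq_zero_iff.1 hb
    obtain rfl := Option.some.inj hd
    exact ⟨_, v, m, rfl, rfl⟩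
  · rintro ⟨i, v, m, rfl, -⟩
    exact ⟨v.map some, m.toList.map some, by simp, run_map_some_eq_zero_iff.2 ⟨m, rfl⟩⟩

section Classes

variable {Q : Set (List Bead)} {τ : PearlTree}

lemma mem_Csquare :
    τ ∈ Csquare Q ↔ τ.root = .square ∧ τ.HasNecklacesIn Q ∧ τ.limbs.All CEdge (· = .square) := by
  have hsquare (x : Pearl) : x = .square ↔ (x ≠ .disc ∧ x ≠ .diamond) ∧ x ≠ .triangle := by
    rcases x with _ | _ | _ | _ <;> simp
  have hdefects : τ.NoDefects ↔ ∀ x ∈ τ.limbs.frees, x ≠ .triangle :=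
    List.forall_mem_ne'.symm
  rw [all_iff]
  simp only [Csquare, IsCompanionTree, Set.mem_ofPred_eq, hdefects, hsquare, forall_and, CEdge]
  tauto

lemma mem_F₀ :
    τ ∈ F₀ Q ↔ τ.root = .square ∧ τ.HasNecklacesIn Q ∧ τ.limbs.All QEdge (· = .triangle) ∧
      τ.limbs.NonNeg ∧ excess τ.limbs.pearls = 0 := by
  simp only [F₀, IsNonNegQTree, IsQTree, Set.mem_ofPred_eq, PearlTree.pearls, all_iff, QEdge]
  constructor
  · rintro ⟨⟨⟨hroot, hQ, hall⟩, -, hnn⟩, hexcess⟩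
    rw [hroot, excess_square_cons] at hexcess
    exact ⟨hroot, hQ, hall, hnn, hexcess⟩
  · rintro ⟨hroot, hQ, hall, hnn, hexcess⟩
    rw [hroot, excess_square_cons]
    exact ⟨⟨⟨rfl, hQ, hall⟩, hexcess.ge, hnn⟩, hexcess⟩

lemma oneSquare_cycles_of_root_eq (hroot : τ.root = .square) (h : τ.HasNecklacesIn Q) :
    OneSquare (⟨.square, τ.limbs⟩ : PearlTree).cycles := by
  have := h.oneSquare
  rwa [PearlTree.ext_of_root_eq (τ' := ⟨.square, τ.limbs⟩) hroot rfl rfl] at this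

lemma rise_walk_of_mem_Csquare (h : τ ∈ Csquare Q) : rise τ.limbs.walk = 0 := by
  obtain ⟨hroot, hQ, hall⟩ := mem_Csquare.1 h
  exact rise_walk_eq_zero (all_cFree_of_all_square hall) (oneSquare_cycles_of_root_eq hroot hQ)

lemma balanced_iff (h : τ ∈ Csquare Q) : τ.Balanced ↔ run 0 τ.limbs.walk = some 0 := by
  have hwalk := walk_eq_contour (mem_Csquare.1 h).2.2
  have hrise := rise_walk_of_mem_Csquare h
  rw [hwalk] at hrise ⊢
  rw [← forall_not_closureMatches_iff hrise, PearlTree.Balanced, PearlTree.contour,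
    (mem_Csquare.1 h).1]
  rfl

lemma mem_B₀ : τ ∈ B₀ Q ↔ τ ∈ Csquare Q ∧ run 0 τ.limbs.walk = some 0 :=
  and_congr_right balanced_iff

lemma mem_U₀ : τ ∈ U₀ Q ↔ τ ∈ Csquare Q ∧ run 0 τ.limbs.walk ≠ some 0 :=
  and_congr_right fun h => not_congr (balanced_iff h)

lemma disjoint_B₀_U₀ (Q : Set (List Bead)) : Disjoint (B₀ Q) (U₀ Q) :=
  Set.disjoint_left.2 fun _ hB hU => hU.2 hB.2

lemma B₀_union_U₀ (Q : Set (List Bead)) : B₀ Q ∪ U₀ Q = Csquare Q := by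
  ext τ
  simp only [B₀, U₀, Set.mem_union, Set.mem_ofPred_eq]
  tauto

end Classes

/-! ### The bijections -/

section Bijections

variable {Q : Set (List Bead)} {τ τ' : PearlTree}

lemma exists_rewire (h : τ ∈ F₀ Q) : ∃ L', Rewire τ.limbs L' := by
  obtain ⟨hroot, hQ, hall, hnn, -⟩ := mem_F₀.1 h
  exact Rewire.exists_right hall (oneSquare_cycles_of_root_eq hroot hQ) hnn

lemma exists_rewire_left (h : τ' ∈ B₀ Q) : ∃ L, Rewire L τ'.limbs := by
  obtain ⟨hC, hrun⟩ := mem_B₀.1 h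
  obtain ⟨hroot, hQ, hall⟩ := mem_Csquare.1 hC
  exact Rewire.exists_left (all_cFree_of_all_square hall) (oneSquare_cycles_of_root_eq hroot hQ)
    hrun

lemma Rewire.cycles_eq_of_root_eq (h : Rewire τ.limbs τ'.limbs) (hroot : τ.root = .square)
    (hroot' : τ'.root = .square) : τ'.cycles = τ.cycles := by
  obtain ⟨x, L⟩ := τ
  obtain ⟨x', L'⟩ := τ'
  obtain rfl : x = .square := hroot
  obtain rfl : x' = .square := hroot'
  exact h.tree_cycles_eq .square

lemma Rewire.mem_B₀ (h : Rewire τ.limbs τ'.limbs) (hτ : τ ∈ F₀ Q) (hroot' : τ'.root = .square) :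
    τ' ∈ B₀ Q := by
  obtain ⟨hroot, hQ, -, -, hexcess⟩ := mem_F₀.1 hτ
  have hnone : none ∉ τ'.limbs.walk := by
    have := h.count_none_walk
    rw [hexcess] at this
    exact List.count_eq_zero.1 (by exact_mod_cast this)
  obtain ⟨hedges, hfrees⟩ := all_iff.1 h.all_right
  refine _root_.mem_B₀.2 ⟨mem_Csquare.2 ⟨hroot', hQ.congr (h.cycles_eq_of_root_eq hroot hroot'),
    all_iff.2 ⟨hedges, fun x hx => ?_⟩⟩, h.run_walk⟩
  rcases x with _ | _ | _ | _
  exacts [rfl, ((hfrees _ hx).1 rfl).elim, ((hfrees _ hx).2 rfl).elim,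
    (hnone (none_mem_walk_iff.2 hx)).elim]

lemma Rewire.mem_F₀ (h : Rewire τ.limbs τ'.limbs) (hτ' : τ' ∈ B₀ Q) (hroot : τ.root = .square) :
    τ ∈ F₀ Q := by
  obtain ⟨hroot', hQ, hall⟩ := mem_Csquare.1 (_root_.mem_B₀.1 hτ').1
  refine _root_.mem_F₀.2 ⟨hroot, hQ.congr (h.cycles_eq_of_root_eq hroot hroot').symm, h.all_left,
    h.nonNeg, ?_⟩
  rw [← h.count_none_walk, List.count_eq_zero.2 (none_notMem_walk hall), Nat.cast_zero]

/-- The companion tree obtained from a non-negative `Q`-tree of excess `0` by `Rewire`. -/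
noncomputable def rewire (τ : F₀ Q) : B₀ Q :=
  ⟨⟨.square, (exists_rewire τ.2).choose⟩, (exists_rewire τ.2).choose_spec.mem_B₀ τ.2 rfl⟩

lemma rewire_spec (τ : F₀ Q) : Rewire τ.1.limbs (rewire τ).1.limbs :=
  (exists_rewire τ.2).choose_spec

lemma rewire_injective : Function.Injective (rewire (Q := Q)) := by
  intro τ τ' h
  have hτ := rewire_spec τ
  rw [h] at hτ
  exact Subtype.ext (PearlTree.ext_of_root_eq (mem_F₀.1 τ.2).1 (mem_F₀.1 τ'.2).1
    (hτ.left_unique (rewire_spec τ')))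

lemma rewire_surjective : Function.Surjective (rewire (Q := Q)) := by
  intro τ'
  obtain ⟨L, hL⟩ := exists_rewire_left τ'.2
  have hmem : (⟨.square, L⟩ : PearlTree) ∈ F₀ Q := Rewire.mem_F₀ hL τ'.2 rfl
  exact ⟨⟨_, hmem⟩, Subtype.ext (PearlTree.ext_of_root_eq rfl
    (mem_Csquare.1 (mem_B₀.1 τ'.2).1).1 ((rewire_spec ⟨_, hmem⟩).right_unique hL))⟩

lemma cycles_rewire (τ : F₀ Q) : (rewire τ).1.cycles = τ.1.cycles :=
  (rewire_spec τ).cycles_eq_of_root_eq (mem_F₀.1 τ.2).1 rfl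

/-- A free `□`-pearl of `τ` other than the root, given by its position on the walk. -/
abbrev SquarePlace (τ : PearlTree) : Type := {n : ℕ // τ.limbs.walk[n]? = some (some .D)}

lemma SquarePlace.exists_spine (n : SquarePlace τ) :
    ∃ s : Spine, τ.limbs = s.plug (free .square) ∧ s.left.length = n := by
  obtain ⟨hn, hD⟩ := List.getElem?_eq_some_iff.1 n.2
  have hwalk := (List.take_append_drop n.1 τ.limbs.walk).symm
  rw [List.drop_eq_getElem_cons hn, hD] at hwalk
  obtain ⟨s, x, hs, hx, hleft, -⟩ := Spine.exists_plug (by simp) hwalk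
  obtain rfl := freeSteps_eq_down.1 hx
  exact ⟨s, hs, by rw [hleft, List.length_take]; omega⟩

/-- The end of a spine that leads to a free `□`-pearl. -/
def Spine.squarePlace {s : Spine} (h : τ.limbs = s.plug (free .square)) : SquarePlace τ :=
  ⟨s.left.length, by simp [h, Spine.walk_plug_free, freeSteps]⟩

/-- The tree `⟨□, s.plug (free □)⟩` rerooted at the other end of the spine `s`. -/
def Spine.reroot (s : Spine) : PearlTree := ⟨.square, s.rev.plug (free .square)⟩

lemma Spine.walk_reroot (s : Spine) :
    s.reroot.limbs.walk = s.right ++ some .D :: s.left := by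
  simp [reroot, walk_plug_free, freeSteps]

lemma Spine.cycles_reroot {s : Spine} (hroot : τ.root = .square)
    (hs : τ.limbs = s.plug (free .square)) : s.reroot.cycles = τ.cycles := by
  rw [reroot, PearlTree.cycles_rev,
    PearlTree.ext_of_root_eq (τ' := ⟨.square, s.plug (free .square)⟩) hroot rfl hs]

lemma Spine.reroot_mem_Csquare {s : Spine} (hτ : τ ∈ Csquare Q)
    (hs : τ.limbs = s.plug (free .square)) : s.reroot ∈ Csquare Q := by
  obtain ⟨hroot, hQ, hall⟩ := mem_Csquare.1 hτ
  refine mem_Csquare.2 ⟨rfl, hQ.congr (cycles_reroot hroot hs), ?_⟩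
  rw [hs, all_plug] at hall
  rwa [reroot, all_plug, all_rev CEdge.comm]

lemma run_of_mem_B₀ {s : Spine} (hτ : τ ∈ B₀ Q) (hs : τ.limbs = s.plug (free .square)) :
    run 0 (s.left ++ some .D :: s.right) = some 0 := by
  simpa [hs, Spine.walk_plug_free, freeSteps] using (mem_B₀.1 hτ).2

lemma Spine.reroot_mem_U₀ {s : Spine} (hτ : τ ∈ B₀ Q) (hs : τ.limbs = s.plug (free .square)) :
    s.reroot ∈ U₀ Q :=
  mem_U₀.2 ⟨reroot_mem_Csquare hτ.1 hs,
    by rw [walk_reroot]; exact run_conjugate_ne (run_of_mem_B₀ hτ hs)⟩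

/-- The balanced tree `p.1` rerooted at its free `□`-pearl `p.2`. -/
noncomputable def rerootAt (p : Σ τ : B₀ Q, SquarePlace τ.1) : U₀ Q :=
  ⟨p.2.exists_spine.choose.reroot,
    Spine.reroot_mem_U₀ p.1.2 p.2.exists_spine.choose_spec.1⟩

lemma rerootAt_spec (p : Σ τ : B₀ Q, SquarePlace τ.1) : ∃ s : Spine,
    p.1.1.limbs = s.plug (free .square) ∧ s.left.length = p.2 ∧ (rerootAt p).1 = s.reroot :=
  ⟨_, p.2.exists_spine.choose_spec.1, p.2.exists_spine.choose_spec.2, rfl⟩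

lemma cycles_rerootAt (p : Σ τ : B₀ Q, SquarePlace τ.1) :
    (rerootAt p).1.cycles = p.1.1.cycles := by
  obtain ⟨s, hs, -, hreroot⟩ := rerootAt_spec p
  rw [hreroot, Spine.cycles_reroot (mem_Csquare.1 p.1.2.1).1 hs]

lemma Spine.plug_square_inj {s t : Spine} (h : s.plug (free .square) = t.plug (free .square))
    (hleft : s.left.length = t.left.length) : s = t :=
  (plug_inj (by simp [freeSteps]) (by simp [freeSteps]) h hleft).1

lemma rerootAt_injective : Function.Injective (rerootAt (Q := Q)) := by
  rintro ⟨τ, n⟩ ⟨τ', n'⟩ h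
  obtain ⟨s, hs, hn, hreroot⟩ := rerootAt_spec ⟨τ, n⟩
  obtain ⟨s', hs', hn', hreroot'⟩ := rerootAt_spec ⟨τ', n'⟩
  rw [h, hreroot'] at hreroot
  have hwalk := congrArg (fun τ => τ.limbs.walk) hreroot
  simp only [Spine.walk_reroot] at hwalk
  have hright : s'.right = s.right :=
    conjugate_unique hwalk (run_of_mem_B₀ τ'.2 hs') (run_of_mem_B₀ τ.2 hs)
  have hrev : s'.rev = s.rev :=
    Spine.plug_square_inj (congrArg PearlTree.limbs hreroot) (by simp [hright])
  obtain rfl : s' = s := by rw [← s'.rev_rev, hrev, s.rev_rev]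
  obtain rfl : τ = τ' := Subtype.ext (PearlTree.ext_of_root_eq (mem_Csquare.1 τ.2.1).1
    (mem_Csquare.1 τ'.2.1).1 (hs.trans hs'.symm))
  obtain rfl : n = n' := Subtype.ext (hn.symm.trans hn')
  rfl

lemma rerootAt_surjective : Function.Surjective (rerootAt (Q := Q)) := by
  intro τ
  obtain ⟨hC, hrun⟩ := mem_U₀.1 τ.2
  obtain ⟨hroot, -, hall⟩ := mem_Csquare.1 hC
  obtain ⟨a, b, hwalk, hab⟩ :=
    exists_conjugate (none_notMem_walk hall) (rise_walk_of_mem_Csquare hC) hrun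
  obtain ⟨s, x, hs, hx, rfl, rfl⟩ := Spine.exists_plug (by simp) hwalk
  obtain rfl := freeSteps_eq_down.1 hx
  have hB : s.reroot ∈ B₀ Q :=
    mem_B₀.2 ⟨Spine.reroot_mem_Csquare hC hs, by rw [Spine.walk_reroot]; exact hab⟩
  let p : Σ τ : B₀ Q, SquarePlace τ.1 := ⟨⟨_, hB⟩, s.rev.squarePlace rfl⟩
  obtain ⟨t, ht, hleft, hreroot⟩ := rerootAt_spec p
  obtain rfl : s.rev = t := Spine.plug_square_inj ht hleft.symm
  refine ⟨p, Subtype.ext (hreroot.trans (PearlTree.ext_of_root_eq rfl hroot ?_))⟩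
  rw [hs, Spine.reroot, Spine.rev_rev]

/-- An enumeration of the positions of `a` in the list `l`. -/
noncomputable def positionEquiv {α : Type*} [BEq α] [LawfulBEq α] (l : List α) (a : α) :
    {n : ℕ // l[n]? = some a} ≃ Fin (l.count a) :=
  let e : {n : ℕ // l[n]? = some a} ≃ {i : Fin l.length // l.get i = a} :=
    { toFun n := ⟨⟨n, (List.getElem?_eq_some_iff.1 n.2).1⟩, (List.getElem?_eq_some_iff.1 n.2).2⟩
      invFun i := ⟨i, List.getElem?_eq_some_iff.2 ⟨i.1.2, i.2⟩⟩
      left_inv _ := rfl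
      right_inv _ := rfl }
  e.trans <| by
    classical
    refine Fintype.equivFinOfCardEq ?_
    rw [Fintype.card_subtype]
    convert Fin.card_filter_univ_eq_vector_get_eq_count a ⟨l, rfl⟩ <;> rfl

lemma count_down_walk_rewire (τ : F₀ Q) :
    (rewire τ).1.limbs.walk.count (some .D) = τ.1.pearls.count .diamond := by
  have hC := (mem_B₀.1 (rewire τ).2).1
  have hrise := rise_walk_of_mem_Csquare hC
  have hup := count_up_walk (mem_Csquare.1 hC).2.2
  rw [rise] at hrise
  rw [(PearlTree.pearls_perm_of_cycles_eq (cycles_rewire τ)).symm.count_eq, PearlTree.pearls,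
    (mem_Csquare.1 hC).1, List.count_cons_of_ne (by simp), ← hup]
  omega

/-- Any bijection between the `♦`-pearls of a tree of `𝓕₀` and the free `□`-pearls of the
corresponding balanced tree will do, as only their numbers matter. -/
noncomputable def diamondEquiv (τ : F₀ Q) :
    {n : ℕ // τ.1.pearls[n]? = some Pearl.diamond} ≃ SquarePlace (rewire τ).1 :=
  (positionEquiv _ _).trans
    ((finCongr (count_down_walk_rewire τ).symm).trans (positionEquiv _ _).symm)

end Bijections

section Equivs

variable (Q : Set (List Bead))

/-- The bijection between non-negative `Q`-trees of excess `0` and balanced companion trees. -/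
noncomputable def rewireEquiv : F₀ Q ≃ B₀ Q :=
  Equiv.ofBijective rewire ⟨rewire_injective, rewire_surjective⟩

/-- A marked tree as a tree with one of its `♦`-pearls. -/
def markedEquiv :
    F₀diamond Q ≃ Σ τ : F₀ Q, {n : ℕ // τ.1.pearls[n]? = some Pearl.diamond} where
  toFun p := ⟨⟨p.1.1, p.2.1⟩, ⟨p.1.2, p.2.2⟩⟩
  invFun p := ⟨(p.1.1, p.2.1), p.1.2, p.2.2⟩
  left_inv _ := rfl
  right_inv _ := rfl

/-- The bijection between marked trees and unbalanced companion trees. -/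
noncomputable def unbalancedEquiv : F₀diamond Q ≃ U₀ Q :=
  ((markedEquiv Q).trans (Equiv.sigmaCongr (rewireEquiv Q) diamondEquiv)).trans
    (Equiv.ofBijective rerootAt ⟨rerootAt_injective, rerootAt_surjective⟩)

variable {Q}

lemma necklaces_rewireEquiv (τ : F₀ Q) : (rewireEquiv Q τ).1.necklaces = τ.1.necklaces :=
  (mem_F₀.1 τ.2).2.1.necklaces_congr (cycles_rewire τ)

lemma necklaces_unbalancedEquiv (p : F₀diamond Q) :
    (unbalancedEquiv Q p).1.necklaces = p.1.1.necklaces :=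
  (mem_F₀.1 p.2.1).2.1.necklaces_congr
    ((cycles_rerootAt _).trans (cycles_rewire ⟨p.1.1, p.2.1⟩))

variable (Q)

theorem exists_necklacePreserving_equiv :
    ∃ φ : (F₀ Q ⊕ F₀diamond Q) ≃ ((B₀ Q ∪ U₀ Q : Set PearlTree)),
      (∀ τ : F₀ Q, (φ (Sum.inl τ)).1 ∈ B₀ Q ∧ (φ (Sum.inl τ)).1.necklaces = τ.1.necklaces) ∧
      (∀ p : F₀diamond Q, (φ (Sum.inr p)).1 ∈ U₀ Q ∧
        (φ (Sum.inr p)).1.necklaces = p.1.1.necklaces) := by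
  classical
  exact ⟨(Equiv.sumCongr (rewireEquiv Q) (unbalancedEquiv Q)).trans
    (Equiv.Set.union (disjoint_B₀_U₀ Q)).symm,
    fun τ => ⟨(rewireEquiv Q τ).2, necklaces_rewireEquiv τ⟩,
    fun p => ⟨(unbalancedEquiv Q p).2, necklaces_unbalancedEquiv p⟩⟩

end Equivs

/-! ### Generating functions -/

/-- The class `S`, with the size function `f`, has finitely many elements of each size. -/
def FiniteBySize {α : Type} (S : Set α) (f : α → ℕ) : Prop := ∀ n, {a ∈ S | f a = n}.Finite

section GenFun

variable {α β : Type} {S S' : Set α} {T : Set β} {f : α → ℕ} {g : β → ℕ}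

lemma coeff_genFun (S : Set α) (f : α → ℕ) (n : ℕ) :
    (genFun S f).coeff n = {a ∈ S | f a = n}.ncard := PowerSeries.coeff_mk _ _

/-- The elements of size `n` of two classes in size-preserving bijection. -/
def sizeEquiv (e : S ≃ T) (h : ∀ a, g (e a).1 = f a.1) (n : ℕ) :
    {a ∈ S | f a = n} ≃ {b ∈ T | g b = n} :=
  (Equiv.subtypeSubtypeEquivSubtypeInter (· ∈ S) (f · = n)).symm.trans
    ((e.subtypeEquiv fun a => by rw [h]).trans
      (Equiv.subtypeSubtypeEquivSubtypeInter (· ∈ T) (g · = n)))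

lemma FiniteBySize.congr (hT : FiniteBySize T g) (e : S ≃ T) (h : ∀ a, g (e a).1 = f a.1) :
    FiniteBySize S f := fun n =>
  have := (hT n).to_subtype
  Set.finite_coe_iff.1 (Finite.of_equiv _ (sizeEquiv e h n).symm)

lemma genFun_congr (e : S ≃ T) (h : ∀ a, g (e a).1 = f a.1) : genFun S f = genFun T g := by
  ext n
  rw [coeff_genFun, coeff_genFun]
  exact Nat.card_congr (sizeEquiv e h n)

lemma genFun_image {φ : α → β} (hφ : Set.InjOn φ S) (h : ∀ a ∈ S, g (φ a) = f a) :
    genFun (φ '' S) g = genFun S f :=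
  (genFun_congr (Equiv.Set.imageOfInjOn φ S hφ) fun a => h a.1 a.2).symm

lemma FiniteBySize.mono (hS' : FiniteBySize S' f) (h : S ⊆ S') : FiniteBySize S f := fun n =>
  (hS' n).subset fun _ ha => ⟨h ha.1, ha.2⟩

lemma genFun_union (h : Disjoint S S') (hfin : FiniteBySize (S ∪ S') f) :
    genFun (S ∪ S') f = genFun S f + genFun S' f := by
  ext n
  rw [map_add, coeff_genFun, coeff_genFun, coeff_genFun, ← Set.ncard_union_eq
    (h.mono (Set.sep_subset _ _) (Set.sep_subset _ _))
    (hfin.mono Set.subset_union_left n) (hfin.mono Set.subset_union_right n)]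
  congr 1
  exact Set.sep_union

lemma genFun_succ (S : Set α) (f : α → ℕ) :
    genFun S (fun a => f a + 1) = PowerSeries.X * genFun S f := by
  ext n
  cases n with
  | zero => simp [coeff_genFun]
  | succ n => simp [coeff_genFun, PowerSeries.coeff_succ_X_mul]

lemma genFun_singleton {a : α} (h : f a = 0) : genFun {a} f = 1 := by
  ext n
  rw [coeff_genFun, PowerSeries.coeff_one]
  split_ifs with hn
  · rw [show {b ∈ ({a} : Set α) | f b = n} = {a} by aesop, Set.ncard_singleton]
  · rw [show {b ∈ ({a} : Set α) | f b = n} = ∅ by aesop, Set.ncard_empty]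

lemma FiniteBySize.prod (hS : FiniteBySize S f) (hT : FiniteBySize T g) :
    FiniteBySize (S ×ˢ T) fun p => f p.1 + g p.2 := by
  intro n
  refine ((Finset.HasAntidiagonal.antidiagonal n).finite_toSet.biUnion
    fun q _ => (hS q.1).prod (hT q.2)).subset ?_
  rintro ⟨a, b⟩ ⟨⟨ha, hb⟩, h⟩
  simp only [Set.mem_iUnion]
  exact ⟨(f a, g b), by simpa using h, ⟨ha, rfl⟩, ⟨hb, rfl⟩⟩

lemma genFun_prod (hS : FiniteBySize S f) (hT : FiniteBySize T g) :
    genFun (S ×ˢ T) (fun p => f p.1 + g p.2) = genFun S f * genFun T g := by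
  classical
  ext n
  have hfin := hS.prod hT n
  have hfiber : ∀ q ∈ Finset.HasAntidiagonal.antidiagonal n,
      {p ∈ hfin.toFinset | (f p.1, g p.2) = q}.card =
        {a ∈ S | f a = q.1}.ncard * {b ∈ T | g b = q.2}.ncard := by
    rintro ⟨i, j⟩ hq
    obtain rfl := Finset.HasAntidiagonal.mem_antidiagonal.1 hq
    rw [← Set.ncard_prod, ← Set.ncard_coe_finset]
    congr 1
    ext ⟨a, b⟩
    simp only [Finset.coe_filter, Set.Finite.mem_toFinset, Set.mem_ofPred_eq, Set.mem_prod,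
      Prod.ext_iff]
    grind
  rw [PowerSeries.coeff_mul, coeff_genFun, Set.ncard_eq_toFinset_card _ hfin,
    Finset.card_eq_sum_card_fiberwise (f := fun p => (f p.1, g p.2))
      (t := Finset.HasAntidiagonal.antidiagonal n)
      fun p hp => by simpa using (hfin.mem_toFinset.1 hp).2]
  exact Finset.sum_congr rfl fun q hq => by rw [hfiber q hq, coeff_genFun, coeff_genFun]

end GenFun

instance : Finite Bead :=
  Finite.of_surjective ![Bead.disc, .diamond, .triangle] (by
    rintro (_ | _ | _)
    exacts [⟨0, rfl⟩, ⟨1, rfl⟩, ⟨2, rfl⟩])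

instance : Finite Pearl :=
  Finite.of_injective Pearl.bead? (by rintro (_ | _) (_ | _) <;> simp [Pearl.bead?])

namespace Limbs

lemma length_pearls (L : Limbs) : L.pearls.length = L.frees.length + 2 * L.vertices.length := by
  induction L with
  | nil => rfl
  | free x rest ih => simp [pearls, frees, vertices, ih]; omega
  | edge x y S rest ihS ih => simp [pearls, frees, vertices, ihS, ih]; omega

lemma count_frees_le (x : Pearl) (L : Limbs) : L.frees.count x ≤ L.pearls.count x := by
  induction L with
  | nil => rfl
  | free y rest ih => simp only [pearls, frees, List.count_cons]; omega
  | edge y z S rest ihS ih => simp only [pearls, frees, List.count_cons, List.count_append]; omega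

lemma card_cycles (L : Limbs) : L.cycles.card = L.vertices.length := by simp [cycles]

lemma count_square_pearls {L : Limbs} (hL : OneSquare L.cycles) :
    L.pearls.count .square = L.row.count .square + L.vertices.length := by
  have hcycles : ((L.cycles.map Cycle.toMultiset).sum).count .square = L.cycles.card := by
    rw [← Multiset.coe_countAddMonoidHom, map_multiset_sum, Multiset.map_map,
      Multiset.map_congr (g := fun _ => 1) rfl (by exact hL), Multiset.map_const',
      Multiset.sum_replicate, smul_eq_mul, mul_one]
  rw [← Multiset.coe_count, coe_pearls, Multiset.count_add, hcycles, Multiset.coe_count,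
    card_cycles]

lemma length_pearls_le {r : Pearl → Pearl → Prop} {L : Limbs} (hall : L.All r (· = .square))
    (hL : OneSquare L.cycles) :
    L.pearls.length ≤ L.row.count .square + 3 * L.vertices.length := by
  have hfrees : L.frees.count .square = L.frees.length :=
    List.count_eq_length.2 fun x hx => ((all_iff.1 hall).2 x hx).symm
  have := count_frees_le .square L
  rw [length_pearls]
  rw [count_square_pearls hL] at this
  omega

lemma finite_setOf_length_pearls_le (N : ℕ) : {L : Limbs | L.pearls.length ≤ N}.Finite := by
  induction N with
  | zero =>
    refine (Set.finite_singleton nil).subset fun L hL => ?_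
    cases L <;> simp_all [pearls]
  | succ N ih =>
    refine ((Set.finite_singleton nil).union (((Set.finite_univ.prod ih).image
      fun p : Pearl × Limbs => free p.1 p.2).union (((Set.finite_univ.prod
      (ih.prod ih)).image fun p : (Pearl × Pearl) × Limbs × Limbs =>
        edge p.1.1 p.1.2 p.2.1 p.2.2)))).subset fun L hL => ?_
    cases L with
    | nil => exact Or.inl rfl
    | free x rest =>
      exact Or.inr (Or.inl ⟨(x, rest), ⟨trivial, by simpa [pearls] using hL⟩, rfl⟩)
    | edge x y S rest =>
      simp only [pearls, Set.mem_ofPred_eq, List.length_cons, List.length_append] at hL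
      refine Or.inr (Or.inr ⟨((x, y), S, rest), ⟨trivial, ?_, ?_⟩, rfl⟩) <;>
        simp only [Set.mem_ofPred_eq] <;> omega

lemma finiteBySize_of_oneSquare (r : Pearl → Pearl → Prop) (N : ℕ) :
    FiniteBySize {L : Limbs | L.row.count .square ≤ N ∧ L.All r (· = .square) ∧ OneSquare L.cycles}
      fun L => L.vertices.length := by
  refine fun n => (finite_setOf_length_pearls_le (N + 3 * n)).subset ?_
  rintro L ⟨⟨hrow, hall, hL⟩, rfl⟩
  exact (length_pearls_le hall hL).trans (Nat.add_le_add_right hrow _)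

end Limbs

section Classes

variable {Q : Set (List Bead)}

lemma size_rewireEquiv (τ : F₀ Q) : (rewireEquiv Q τ).1.size = τ.1.size := by
  rw [PearlTree.size_eq_card_cycles, PearlTree.size_eq_card_cycles]
  exact congrArg Multiset.card (cycles_rewire τ)

lemma size_unbalancedEquiv (p : F₀diamond Q) : (unbalancedEquiv Q p).1.size = p.1.1.size := by
  rw [PearlTree.size_eq_card_cycles, PearlTree.size_eq_card_cycles]
  exact congrArg Multiset.card ((cycles_rerootAt _).trans (cycles_rewire ⟨p.1.1, p.2.1⟩))

variable (Q)

lemma finiteBySize_Csquare : FiniteBySize (Csquare Q) PearlTree.size := by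
  intro n
  refine ((finiteBySize_of_oneSquare CEdge 0 (n - 1)).image (PearlTree.mk .square)).subset ?_
  rintro ⟨x, L⟩ ⟨hC, rfl⟩
  obtain ⟨rfl, hQ, hall⟩ := mem_Csquare.1 hC
  obtain ⟨hrow, hL⟩ := oneSquare_square_cycles.1 hQ.oneSquare
  exact ⟨L, ⟨⟨(List.count_eq_zero.2 hrow).le, hall, hL⟩, rfl⟩, rfl⟩

lemma finiteBySize_F₀ : FiniteBySize (F₀ Q) PearlTree.size :=
  ((finiteBySize_Csquare Q).mono fun _ h => h.1).congr (rewireEquiv Q) size_rewireEquiv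

lemma finiteBySize_F₀diamond : FiniteBySize (F₀diamond Q) fun p => p.1.size :=
  ((finiteBySize_Csquare Q).mono fun _ h => h.1).congr (unbalancedEquiv Q) size_unbalancedEquiv

theorem genFun_F₀_add_genFun_F₀diamond :
    genFun (F₀ Q) PearlTree.size + genFun (F₀diamond Q) (fun p => p.1.size) =
      genFun (Csquare Q) PearlTree.size := by
  have hfin : FiniteBySize (B₀ Q ∪ U₀ Q) PearlTree.size := by
    rw [B₀_union_U₀]
    exact finiteBySize_Csquare Q
  rw [genFun_congr (rewireEquiv Q) size_rewireEquiv,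
    genFun_congr (unbalancedEquiv Q) size_unbalancedEquiv,
    ← genFun_union (disjoint_B₀_U₀ Q) hfin, B₀_union_U₀]

end Classes

/-! ### Decomposition at the root -/

/-- The clockwise cyclic sequence of pearls `c` is a copy of a necklace of `Q`. -/
def IsNecklace (Q : Set (List Bead)) (c : List Pearl) : Prop :=
  c.count .square = 1 ∧ necklaceWord c ∈ Q

/-- What hangs, in companion trees without defects, at consecutive pearls `w` of a vertex. -/
def rowLimbs (Q : Set (List Bead)) (w : List Pearl) : Set Limbs :=
  {L | L.row = w ∧ L.All CEdge (· = .square) ∧ ∀ c ∈ L.vertices, IsNecklace Q c}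

/-- What hangs, in companion trees without defects, at a vertex reached from its pearl `y`. -/
def plantedLimbs (Q : Set (List Bead)) (y : Pearl) : Set Limbs :=
  {L | IsNecklace Q (y :: L.row) ∧ L.All CEdge (· = .square) ∧ ∀ c ∈ L.vertices, IsNecklace Q c}

/-- The generating function of limbs, by the number of vertices beyond the first one. -/
noncomputable def limbsGenFun (S : Set Limbs) : ℕ⟦X⟧ := genFun S fun L => L.vertices.length

namespace Limbs

lemma oneSquare_cycles {Q : Set (List Bead)} {L : Limbs} (h : ∀ c ∈ L.vertices, IsNecklace Q c) :
    OneSquare L.cycles := by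
  intro c hc
  obtain ⟨l, hl, rfl⟩ := List.mem_map.1 (Multiset.mem_coe.1 hc)
  simpa using (h l hl).1

lemma eq_nil_of_row {L : Limbs} (h : L.row = []) : L = nil := by
  cases L <;> simp_all [row]

lemma vertices_append (L M : Limbs) : (L ++ M).vertices = L.vertices ++ M.vertices := by
  induction L <;> simp_all [vertices]

end Limbs

section RootDecomposition

variable {Q : Set (List Bead)}

lemma finiteBySize_rowLimbs (w : List Pearl) :
    FiniteBySize (rowLimbs Q w) fun L => L.vertices.length :=
  (finiteBySize_of_oneSquare CEdge (w.count .square)).mono fun _ h =>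
    ⟨h.1 ▸ le_rfl, h.2.1, oneSquare_cycles h.2.2⟩

lemma finiteBySize_plantedLimbs (y : Pearl) :
    FiniteBySize (plantedLimbs Q y) fun L => L.vertices.length :=
  (finiteBySize_of_oneSquare CEdge 1).mono fun _ h =>
    ⟨h.1.1 ▸ List.count_le_count_cons, h.2.1, oneSquare_cycles h.2.2⟩

lemma mem_plantedLimbs {y : Pearl} {L : Limbs} : L ∈ plantedLimbs Q y ↔
    ∃ w, IsNecklace Q (y :: w) ∧ L ∈ rowLimbs Q w :=
  ⟨fun h => ⟨_, h.1, rfl, h.2⟩, fun ⟨_, hw, hrow, h⟩ => ⟨hrow.symm ▸ hw, h⟩⟩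

lemma disjoint_rowLimbs {w w' : List Pearl} (h : w ≠ w') :
    Disjoint (rowLimbs Q w) (rowLimbs Q w') :=
  Set.disjoint_left.2 fun _ hL hL' => h (hL.1.symm.trans hL'.1)

lemma free_nil_mem_rowLimbs {x : Pearl} : free x nil ∈ rowLimbs Q [x] ↔ x = .square := by
  simp [rowLimbs, row, Limbs.All, vertices]

lemma edge_nil_mem_rowLimbs {x y : Pearl} {S : Limbs} :
    edge x y S nil ∈ rowLimbs Q [x] ↔ CEdge x y ∧ S ∈ plantedLimbs Q y := by
  simp only [rowLimbs, plantedLimbs, Set.mem_ofPred_eq, row, Limbs.All, vertices, List.append_nil,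
    List.forall_mem_cons]
  tauto

lemma row_eq_singleton {L : Limbs} {x : Pearl} (h : L.row = [x]) :
    L = free x nil ∨ ∃ y S, L = edge x y S nil := by
  cases L with
  | nil => cases h
  | free z R =>
    obtain ⟨rfl, hR⟩ := List.cons.inj h
    exact Or.inl (by rw [eq_nil_of_row hR])
  | edge z y S R =>
    obtain ⟨rfl, hR⟩ := List.cons.inj h
    exact Or.inr ⟨y, S, by rw [eq_nil_of_row hR]⟩

lemma limbsGenFun_image_edge (x y : Pearl) :
    limbsGenFun ((fun S => edge x y S nil) '' plantedLimbs Q y) =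
      PowerSeries.X * limbsGenFun (plantedLimbs Q y) := by
  rw [limbsGenFun, limbsGenFun, ← genFun_succ]
  exact genFun_image (fun S _ S' _ h => by simpa using h) fun S _ => by simp [vertices]

lemma limbsGenFun_union {S S' : Set Limbs} (h : Disjoint S S')
    (hfin : FiniteBySize (S ∪ S') fun L => L.vertices.length) :
    limbsGenFun (S ∪ S') = limbsGenFun S + limbsGenFun S' := genFun_union h hfin

lemma limbsGenFun_rowLimbs_of_linked {x y : Pearl} (hx : x ≠ .square)
    (hy : ∀ z, CEdge x z ↔ z = y) :
    limbsGenFun (rowLimbs Q [x]) = PowerSeries.X * limbsGenFun (plantedLimbs Q y) := by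
  rw [← limbsGenFun_image_edge x y]
  congr 1
  ext L
  constructor
  · intro h
    obtain rfl | ⟨z, S, rfl⟩ := row_eq_singleton h.1
    · exact (hx (free_nil_mem_rowLimbs.1 h)).elim
    · obtain ⟨hz, hS⟩ := edge_nil_mem_rowLimbs.1 h
      obtain rfl := (hy z).1 hz
      exact ⟨S, hS, rfl⟩
  · rintro ⟨S, hS, rfl⟩
    exact edge_nil_mem_rowLimbs.2 ⟨(hy y).2 rfl, hS⟩

lemma cEdge_disc_iff {x : Pearl} : CEdge .disc x ↔ x = .square := by simp [CEdge, Joins]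

lemma cEdge_square_iff {x : Pearl} : CEdge .square x ↔ x = .disc := by simp [CEdge, Joins]

lemma cEdge_diamond_iff {x : Pearl} : CEdge .diamond x ↔ x = .triangle := by simp [CEdge, Joins]

lemma cEdge_triangle_iff {x : Pearl} : CEdge .triangle x ↔ x = .diamond := by simp [CEdge, Joins]

lemma rowLimbs_square : rowLimbs Q [.square] =
    {free .square nil} ∪ (fun S => edge .square .disc S nil) '' plantedLimbs Q .disc := by
  ext L
  constructor
  · intro h
    obtain rfl | ⟨z, S, rfl⟩ := row_eq_singleton h.1
    · exact Or.inl rfl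
    · obtain ⟨hz, hS⟩ := edge_nil_mem_rowLimbs.1 h
      obtain rfl := cEdge_square_iff.1 hz
      exact Or.inr ⟨S, hS, rfl⟩
  · rintro (rfl | ⟨S, hS, rfl⟩)
    · exact free_nil_mem_rowLimbs.2 rfl
    · exact edge_nil_mem_rowLimbs.2 ⟨cEdge_square_iff.2 rfl, hS⟩

lemma limbsGenFun_rowLimbs_square :
    limbsGenFun (rowLimbs Q [.square]) =
      1 + PowerSeries.X * limbsGenFun (plantedLimbs Q .disc) := by
  have hfin := finiteBySize_rowLimbs (Q := Q) [.square]
  rw [rowLimbs_square] at hfin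
  rw [← limbsGenFun_image_edge .square .disc, rowLimbs_square,
    limbsGenFun_union (by simp) hfin]
  exact congrArg (· + _) (genFun_singleton rfl)

lemma rowLimbs_cons (x : Pearl) (w : List Pearl) :
    rowLimbs Q (x :: w) = (fun p => p.1 ++ p.2) '' (rowLimbs Q [x] ×ˢ rowLimbs Q w) := by
  ext L
  constructor
  · rintro ⟨hrow, hall, hvert⟩
    cases L with
    | nil => cases hrow
    | free z R =>
      obtain ⟨rfl, hR⟩ := List.cons.inj hrow
      exact ⟨(free z nil, R), ⟨free_nil_mem_rowLimbs.2 hall.1, hR, hall.2, hvert⟩, rfl⟩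
    | edge z y S R =>
      obtain ⟨rfl, hR⟩ := List.cons.inj hrow
      obtain ⟨hedge, hS, hall⟩ := hall
      obtain ⟨hy, hvert⟩ := List.forall_mem_cons.1 hvert
      rw [List.forall_mem_append] at hvert
      exact ⟨(edge z y S nil, R), ⟨edge_nil_mem_rowLimbs.2 ⟨hedge, hy, hS, hvert.1⟩, hR, hall,
        hvert.2⟩, rfl⟩
  · rintro ⟨⟨L, M⟩, ⟨⟨hrow, hall, hvert⟩, hrow', hall', hvert'⟩, rfl⟩
    refine ⟨?_, all_append.2 ⟨hall, hall'⟩, ?_⟩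
    · rw [row_append, hrow, hrow', List.singleton_append]
    · rw [vertices_append, List.forall_mem_append]
      exact ⟨hvert, hvert'⟩

lemma append_inj_of_row_singleton {L L' M M' : Limbs} {x : Pearl} (hL : L.row = [x])
    (hL' : L'.row = [x]) (h : L ++ M = L' ++ M') : L = L' ∧ M = M' := by
  obtain rfl | ⟨y, S, rfl⟩ := row_eq_singleton hL <;>
    obtain rfl | ⟨y', S', rfl⟩ := row_eq_singleton hL' <;> simp_all

lemma limbsGenFun_rowLimbs_cons (x : Pearl) (w : List Pearl) :
    limbsGenFun (rowLimbs Q (x :: w)) =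
      limbsGenFun (rowLimbs Q [x]) * limbsGenFun (rowLimbs Q w) := by
  rw [rowLimbs_cons, limbsGenFun, limbsGenFun, limbsGenFun,
    ← genFun_prod (finiteBySize_rowLimbs _) (finiteBySize_rowLimbs _)]
  refine genFun_image ?_ fun p _ => by rw [vertices_append, List.length_append]
  rintro ⟨L, M⟩ ⟨hL, -⟩ ⟨L', M'⟩ ⟨hL', -⟩ h
  obtain ⟨rfl, rfl⟩ := append_inj_of_row_singleton hL.1 hL'.1 h
  rfl

lemma Csquare_eq_image_plantedLimbs :
    Csquare Q = PearlTree.mk .square '' plantedLimbs Q .square := by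
  ext τ
  rw [mem_Csquare]
  constructor
  · obtain ⟨x, L⟩ := τ
    rintro ⟨rfl, hQ, hall⟩
    obtain ⟨hroot, hvert⟩ := List.forall_mem_cons.1 hQ
    exact ⟨L, ⟨hroot, hall, hvert⟩, rfl⟩
  · rintro ⟨L, ⟨hroot, hall, hvert⟩, rfl⟩
    exact ⟨rfl, List.forall_mem_cons.2 ⟨hroot, hvert⟩, hall⟩

variable (Q)

lemma genFun_Csquare : genFun (Csquare Q) PearlTree.size =
    PowerSeries.X * limbsGenFun (plantedLimbs Q .square) := by
  rw [limbsGenFun, ← genFun_succ, Csquare_eq_image_plantedLimbs]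
  exact genFun_image (fun L _ L' _ h => by simpa using h) fun L _ => rfl

end RootDecomposition

/-! ### The necklaces `●●`, `▲` and `♦` -/

lemma map_bead_filterMap_bead? {l : List Pearl} (h : .square ∉ l) :
    (l.filterMap Pearl.bead?).map Pearl.bead = l := by
  induction l with
  | nil => rfl
  | cons x l ih =>
    obtain ⟨hx, hl⟩ := not_or.1 (mt List.mem_cons.2 h)
    rcases x with _ | b
    · exact (hx rfl).elim
    · exact congrArg (List.cons (Pearl.bead b)) (ih hl)

lemma isNecklace_iff {Q : Set (List Bead)} {c : List Pearl} : IsNecklace Q c ↔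
    ∃ A B : List Bead, B ++ A ∈ Q ∧
      c = A.map Pearl.bead ++ .square :: B.map Pearl.bead := by
  constructor
  · rintro ⟨hcount, hQ⟩
    obtain ⟨A, B, rfl, hA⟩ := List.eq_append_cons_of_mem
      (List.count_pos_iff.1 (by omega : 0 < c.count Pearl.square))
    have hB : .square ∉ B := by
      rw [List.count_append, List.count_cons_self] at hcount
      exact List.count_eq_zero.1 (by omega)
    rw [necklaceWord_append_square_cons B hA, List.filterMap_append] at hQ
    exact ⟨_, _, hQ, by rw [map_bead_filterMap_bead? hA, map_bead_filterMap_bead? hB]⟩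
  · rintro ⟨A, B, hQ, rfl⟩
    have hbead : ∀ l : List Bead, .square ∉ l.map Pearl.bead := by simp
    have hinv : ∀ l : List Bead, (l.map Pearl.bead).filterMap Pearl.bead? = l := fun l => by
      simp [List.filterMap_map, Function.comp_def, Pearl.bead?]
    refine ⟨?_, ?_⟩
    · rw [List.count_append, List.count_cons_self, List.count_eq_zero.2 (hbead A),
        List.count_eq_zero.2 (hbead B)]
    · rwa [necklaceWord_append_square_cons _ (hbead A), List.filterMap_append, hinv, hinv]

lemma isNecklace_Qlambda_iff {c : List Pearl} : IsNecklace Qlambda c ↔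
    c ∈ ([[.square, .disc, .disc], [.disc, .square, .disc], [.disc, .disc, .square],
      [.square, .triangle], [.triangle, .square], [.square, .diamond], [.diamond, .square]] :
        List (List Pearl)) := by
  rw [isNecklace_iff]
  constructor
  · rintro ⟨A, B, h | h | h, rfl⟩
    · obtain ⟨rfl, rfl⟩ | ⟨_, rfl, h'⟩ := List.append_eq_cons_iff.1 h
      · simp
      · obtain ⟨rfl, rfl⟩ | ⟨rfl, rfl⟩ := List.append_eq_singleton_iff.1 h'.symm <;> simp
    all_goals obtain ⟨rfl, rfl⟩ | ⟨rfl, rfl⟩ := List.append_eq_singleton_iff.1 h <;> simp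
  · simp only [List.mem_cons, List.not_mem_nil, or_false]
    rintro (rfl | rfl | rfl | rfl | rfl | rfl | rfl)
    exacts [⟨[], [.disc, .disc], Or.inl rfl, rfl⟩, ⟨[.disc], [.disc], Or.inl rfl, rfl⟩,
      ⟨[.disc, .disc], [], Or.inl rfl, rfl⟩, ⟨[], [.triangle], Or.inr (Or.inl rfl), rfl⟩,
      ⟨[.triangle], [], Or.inr (Or.inl rfl), rfl⟩, ⟨[], [.diamond], Or.inr (Or.inr rfl), rfl⟩,
      ⟨[.diamond], [], Or.inr (Or.inr rfl), rfl⟩]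

lemma plantedLimbs_square_Qlambda : plantedLimbs Qlambda .square =
    rowLimbs Qlambda [.disc, .disc] ∪ (rowLimbs Qlambda [.triangle] ∪
      rowLimbs Qlambda [.diamond]) := by
  ext L
  simp [mem_plantedLimbs, isNecklace_Qlambda_iff, or_and_right, exists_or]

lemma plantedLimbs_disc_Qlambda : plantedLimbs Qlambda .disc =
    rowLimbs Qlambda [.square, .disc] ∪ rowLimbs Qlambda [.disc, .square] := by
  ext L
  simp [mem_plantedLimbs, isNecklace_Qlambda_iff, or_and_right, exists_or]

lemma plantedLimbs_triangle_Qlambda :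
    plantedLimbs Qlambda .triangle = rowLimbs Qlambda [.square] := by
  ext L
  simp [mem_plantedLimbs, isNecklace_Qlambda_iff]

lemma plantedLimbs_diamond_Qlambda :
    plantedLimbs Qlambda .diamond = rowLimbs Qlambda [.square] := by
  ext L
  simp [mem_plantedLimbs, isNecklace_Qlambda_iff]

lemma limbsGenFun_rowLimbs_disc (Q : Set (List Bead)) :
    limbsGenFun (rowLimbs Q [.disc]) = genFun (Csquare Q) PearlTree.size := by
  rw [genFun_Csquare]
  exact limbsGenFun_rowLimbs_of_linked (by simp) fun _ => cEdge_disc_iff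

lemma limbsGenFun_rowLimbs_diamond_Qlambda : limbsGenFun (rowLimbs Qlambda [.diamond]) =
    PowerSeries.X * limbsGenFun (rowLimbs Qlambda [.square]) := by
  rw [← plantedLimbs_triangle_Qlambda]
  exact limbsGenFun_rowLimbs_of_linked (by simp) fun _ => cEdge_diamond_iff

lemma limbsGenFun_rowLimbs_triangle_Qlambda : limbsGenFun (rowLimbs Qlambda [.triangle]) =
    PowerSeries.X * limbsGenFun (rowLimbs Qlambda [.square]) := by
  rw [← plantedLimbs_diamond_Qlambda]
  exact limbsGenFun_rowLimbs_of_linked (by simp) fun _ => cEdge_triangle_iff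

lemma genFun_Csquare_Qlambda : genFun (Csquare Qlambda) PearlTree.size =
    PowerSeries.X * (genFun (Csquare Qlambda) PearlTree.size ^ 2 +
      2 * PowerSeries.X * limbsGenFun (rowLimbs Qlambda [.square])) := by
  have hfin := finiteBySize_plantedLimbs (Q := Qlambda) .square
  rw [plantedLimbs_square_Qlambda] at hfin
  have hdisj : Disjoint (rowLimbs Qlambda [.disc, .disc])
      (rowLimbs Qlambda [.triangle] ∪ rowLimbs Qlambda [.diamond]) :=
    Set.disjoint_union_right.2 ⟨disjoint_rowLimbs (by simp), disjoint_rowLimbs (by simp)⟩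
  conv_lhs => rw [genFun_Csquare, plantedLimbs_square_Qlambda,
    limbsGenFun_union hdisj hfin, limbsGenFun_union (disjoint_rowLimbs (by simp))
    (hfin.mono Set.subset_union_right)]
  rw [limbsGenFun_rowLimbs_cons, limbsGenFun_rowLimbs_triangle_Qlambda,
    limbsGenFun_rowLimbs_diamond_Qlambda, limbsGenFun_rowLimbs_disc]
  ring

lemma limbsGenFun_rowLimbs_square_Qlambda : limbsGenFun (rowLimbs Qlambda [.square]) =
    1 + 2 * PowerSeries.X * genFun (Csquare Qlambda) PearlTree.size *
      limbsGenFun (rowLimbs Qlambda [.square]) := by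
  have hfin := finiteBySize_plantedLimbs (Q := Qlambda) .disc
  rw [plantedLimbs_disc_Qlambda] at hfin
  conv_lhs => rw [limbsGenFun_rowLimbs_square, plantedLimbs_disc_Qlambda,
    limbsGenFun_union (disjoint_rowLimbs (by simp)) hfin]
  rw [limbsGenFun_rowLimbs_cons .square [.disc], limbsGenFun_rowLimbs_cons .disc [.square],
    limbsGenFun_rowLimbs_disc]
  ring

lemma lambda_cubic_unique {C D : ℤ⟦X⟧}
    (hC : C * (1 - PowerSeries.X * C) * (1 - 2 * PowerSeries.X * C) = 2 * PowerSeries.X ^ 2)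
    (hD : D * (1 - PowerSeries.X * D) * (1 - 2 * PowerSeries.X * D) = 2 * PowerSeries.X ^ 2) :
    C = D := by
  set quotient : ℤ⟦X⟧ :=
    1 - 3 * PowerSeries.X * (C + D) + 2 * PowerSeries.X ^ 2 * (C ^ 2 + C * D + D ^ 2)
    with hquotient
  have hne : quotient ≠ 0 := fun h => by
    simpa [hquotient] using congrArg PowerSeries.constantCoeff h
  have hprod : (C - D) * quotient = 0 := by linear_combination hC - hD
  exact sub_eq_zero.1 ((mul_eq_zero.1 hprod).resolve_right hne)

lemma Csquare_Qlambda_cubic :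
    (genFun (Csquare Qlambda) PearlTree.size).map (Nat.castRingHom ℤ) *
        (1 - PowerSeries.X * (genFun (Csquare Qlambda) PearlTree.size).map (Nat.castRingHom ℤ)) *
        (1 - 2 * PowerSeries.X *
          (genFun (Csquare Qlambda) PearlTree.size).map (Nat.castRingHom ℤ)) =
      2 * PowerSeries.X ^ 2 := by
  have hC := congrArg (PowerSeries.map (Nat.castRingHom ℤ)) genFun_Csquare_Qlambda
  have hR := congrArg (PowerSeries.map (Nat.castRingHom ℤ)) limbsGenFun_rowLimbs_square_Qlambda
  simp only [map_mul, map_add, map_pow, PowerSeries.map_X, map_one, map_ofNat] at hC hR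
  linear_combination (1 - 2 * PowerSeries.X *
    (genFun (Csquare Qlambda) PearlTree.size).map (Nat.castRingHom ℤ)) * hC +
    2 * PowerSeries.X ^ 2 * hR

theorem Csquare_Qlambda_cubic_iff (C : ℤ⟦X⟧) :
    C * (1 - PowerSeries.X * C) * (1 - 2 * PowerSeries.X * C) = 2 * PowerSeries.X ^ 2 ↔
      C = (genFun (Csquare Qlambda) PearlTree.size).map (Nat.castRingHom ℤ) :=
  ⟨fun hC => lambda_cubic_unique hC Csquare_Qlambda_cubic, fun hC => hC ▸ Csquare_Qlambda_cubic⟩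

/-! ### Closed planar `λ`-terms -/

namespace UBTree

/-- The number of variables. -/
def varCount : UBTree → ℕ
  | var => 1
  | abs t => t.varCount
  | app t u => t.varCount + u.varCount

/-- The number of abstractions. -/
def absCount : UBTree → ℕ
  | var => 0
  | abs t => t.absCount + 1
  | app t u => t.absCount + u.absCount

/-- The Hall condition for bindings: no subtree at an abstraction has more abstractions than
variables. -/
def IsBindable : UBTree → Prop
  | var => True
  | abs t => t.absCount + 1 ≤ t.varCount ∧ t.IsBindable
  | app t u => t.IsBindable ∧ u.IsBindable

lemma Abstractions_var : var.Abstractions = ∅ := by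
  ext p
  rcases p with _ | ⟨_ | _, p⟩ <;> simp [Abstractions, subtreeAt]

lemma Abstractions_abs (t : UBTree) :
    (abs t).Abstractions = insert [] (List.cons false '' t.Abstractions) := by
  ext p
  rcases p with _ | ⟨_ | _, p⟩ <;> simp [Abstractions, subtreeAt]

lemma Abstractions_app (t u : UBTree) : (app t u).Abstractions =
    List.cons false '' t.Abstractions ∪ List.cons true '' u.Abstractions := by
  ext p
  rcases p with _ | ⟨_ | _, p⟩ <;> simp [Abstractions, subtreeAt]

lemma Variables_var : var.Variables = {[]} := by
  ext p
  rcases p with _ | ⟨_ | _, p⟩ <;> simp [Variables, subtreeAt]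

lemma Variables_abs (t : UBTree) : (abs t).Variables = List.cons false '' t.Variables := by
  ext p
  rcases p with _ | ⟨_ | _, p⟩ <;> simp [Variables, subtreeAt]

lemma Variables_app (t u : UBTree) : (app t u).Variables =
    List.cons false '' t.Variables ∪ List.cons true '' u.Variables := by
  ext p
  rcases p with _ | ⟨_ | _, p⟩ <;> simp [Variables, subtreeAt]

lemma disjoint_image_cons {α : Type*} {a b : α} (h : a ≠ b) (S T : Set (List α)) :
    Disjoint (List.cons a '' S) (List.cons b '' T) := by
  rw [Set.disjoint_left]
  rintro _ ⟨p, -, rfl⟩ ⟨q, -, hq⟩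
  exact h (List.cons.inj hq).1.symm

lemma ncard_image_cons_union {α : Type*} {a b : α} (h : a ≠ b) {S T : Set (List α)}
    (hS : S.Finite) (hT : T.Finite) :
    (List.cons a '' S ∪ List.cons b '' T).ncard = S.ncard + T.ncard := by
  rw [Set.ncard_union_eq (disjoint_image_cons h S T) (hS.image _) (hT.image _),
    Set.ncard_image_of_injective _ List.cons_injective,
    Set.ncard_image_of_injective _ List.cons_injective]

lemma finite_Abstractions (t : UBTree) : t.Abstractions.Finite := by
  induction t with
  | var => simp [Abstractions_var]
  | abs t ih => rw [Abstractions_abs]; exact (ih.image _).insert _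
  | app t u iht ihu => rw [Abstractions_app]; exact (iht.image _).union (ihu.image _)

lemma finite_Variables (t : UBTree) : t.Variables.Finite := by
  induction t with
  | var => simp [Variables_var]
  | abs t ih => rw [Variables_abs]; exact ih.image _
  | app t u iht ihu => rw [Variables_app]; exact (iht.image _).union (ihu.image _)

lemma ncard_Abstractions (t : UBTree) : t.Abstractions.ncard = t.absCount := by
  induction t with
  | var => simp [Abstractions_var, absCount]
  | abs t ih =>
    rw [Abstractions_abs, Set.ncard_insert_of_notMem (by simp) (t.finite_Abstractions.image _),
      Set.ncard_image_of_injective _ List.cons_injective, ih, absCount]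
  | app t u iht ihu =>
    rw [Abstractions_app, ncard_image_cons_union Bool.false_ne_true t.finite_Abstractions
      u.finite_Abstractions, iht, ihu, absCount]

lemma ncard_Variables (t : UBTree) : t.Variables.ncard = t.varCount := by
  induction t with
  | var => simp [Variables_var, varCount]
  | abs t ih =>
    rw [Variables_abs, Set.ncard_image_of_injective _ List.cons_injective, ih, varCount]
  | app t u iht ihu =>
    rw [Variables_app, ncard_image_cons_union Bool.false_ne_true t.finite_Variables
      u.finite_Variables, iht, ihu, varCount]

/-- `m` restricts to a binding of `t`; as a map between addresses it can be carried from a tree to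
its subtrees and back. -/
def Binds (t : UBTree) (m : List Bool → List Bool) : Prop :=
  Set.MapsTo m t.Abstractions t.Variables ∧ Set.InjOn m t.Abstractions ∧
    ∀ p ∈ t.Abstractions, p <+: m p

namespace Binds

variable {t u : UBTree} {m m' : List Bool → List Bool}

lemma absCount_le (h : t.Binds m) : t.absCount ≤ t.varCount := by
  rw [← ncard_Abstractions, ← ncard_Variables]
  exact Set.ncard_le_ncard_of_injOn m h.1 h.2.1 t.finite_Variables

lemma restrict (h : t.Binds m) (b : Bool)
    (hA : ∀ p ∈ u.Abstractions, b :: p ∈ t.Abstractions)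
    (hV : ∀ p, b :: p ∈ t.Variables → p ∈ u.Variables) :
    u.Binds fun p => (m (b :: p)).tail := by
  obtain ⟨hmaps, hinj, hprefix⟩ := h
  have hcons : ∀ p ∈ u.Abstractions, ∃ q, m (b :: p) = b :: (p ++ q) := fun p hp => by
    obtain ⟨q, hq⟩ := hprefix _ (hA p hp)
    exact ⟨q, hq.symm⟩
  refine ⟨fun p hp => hV _ ?_, fun p hp p' hp' heq => ?_, fun p hp => ?_⟩
  · obtain ⟨q, hq⟩ := hcons p hp
    simpa only [hq, List.tail_cons] using hmaps (hA p hp)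
  · obtain ⟨q, hq⟩ := hcons p hp
    obtain ⟨q', hq'⟩ := hcons p' hp'
    have htail : p ++ q = p' ++ q' := by simpa only [hq, hq', List.tail_cons] using heq
    exact (List.cons.inj (hinj (hA p hp) (hA p' hp') (by rw [hq, hq', htail]))).2
  · obtain ⟨q, hq⟩ := hcons p hp
    exact ⟨q, by simp only [hq, List.tail_cons]⟩

lemma isBindable (h : t.Binds m) : t.IsBindable := by
  induction t generalizing m with
  | var => trivial
  | abs t ih =>
    exact ⟨h.absCount_le, ih (h.restrict false (fun p hp => by simp [Abstractions_abs, hp])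
      fun p hp => by simpa [Variables_abs] using hp)⟩
  | app t u iht ihu =>
    exact ⟨iht (h.restrict false (fun p hp => by simp [Abstractions_app, hp])
        fun p hp => by simpa [Variables_app] using hp),
      ihu (h.restrict true (fun p hp => by simp [Abstractions_app, hp])
        fun p hp => by simpa [Variables_app] using hp)⟩

lemma exists_abs (h : t.Binds m) (hlt : t.absCount < t.varCount) : ∃ m', (abs t).Binds m' := by
  obtain ⟨hmaps, hinj, hprefix⟩ := h
  obtain ⟨v, hv, hfresh⟩ : ∃ v ∈ t.Variables, v ∉ m '' t.Abstractions := by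
    refine Set.exists_mem_notMem_of_ncard_lt_ncard ?_ (t.finite_Abstractions.image _)
    rwa [hinj.ncard_image, ncard_Abstractions, ncard_Variables]
  refine ⟨fun p => false :: p.casesOn v fun _ p => m p, ?_⟩
  rw [Binds, Abstractions_abs, Variables_abs]
  refine ⟨?_, ?_, ?_⟩
  · rintro _ (rfl | ⟨p, hp, rfl⟩)
    exacts [⟨v, hv, rfl⟩, ⟨m p, hmaps hp, rfl⟩]
  · rintro _ (rfl | ⟨p, hp, rfl⟩) _ (rfl | ⟨q, hq, rfl⟩) heq
    · rfl
    · exact (hfresh ⟨q, hq, (List.cons.inj heq).2.symm⟩).elim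
    · exact (hfresh ⟨p, hp, (List.cons.inj heq).2⟩).elim
    · rw [hinj hp hq (List.cons.inj heq).2]
  · rintro _ (rfl | ⟨p, hp, rfl⟩)
    exacts [List.nil_prefix, List.cons_prefix_cons.2 ⟨rfl, hprefix p hp⟩]

lemma exists_app (ht : t.Binds m) (hu : u.Binds m') : ∃ m'', (app t u).Binds m'' := by
  obtain ⟨hmaps, hinj, hprefix⟩ := ht
  obtain ⟨hmaps', hinj', hprefix'⟩ := hu
  refine ⟨fun p => p.casesOn [] fun b p => b :: if b then m' p else m p, ?_⟩
  rw [Binds, Abstractions_app, Variables_app]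
  refine ⟨?_, ?_, ?_⟩
  · rintro _ (⟨p, hp, rfl⟩ | ⟨p, hp, rfl⟩)
    exacts [Or.inl ⟨m p, hmaps hp, rfl⟩, Or.inr ⟨m' p, hmaps' hp, rfl⟩]
  · rintro _ (⟨p, hp, rfl⟩ | ⟨p, hp, rfl⟩) _ (⟨q, hq, rfl⟩ | ⟨q, hq, rfl⟩) heq <;>
      obtain ⟨hb, heq⟩ := List.cons.inj heq
    · rw [hinj hp hq heq]
    · cases hb
    · cases hb
    · rw [hinj' hp hq heq]
  · rintro _ (⟨p, hp, rfl⟩ | ⟨p, hp, rfl⟩)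
    exacts [List.cons_prefix_cons.2 ⟨rfl, hprefix p hp⟩,
      List.cons_prefix_cons.2 ⟨rfl, hprefix' p hp⟩]

end Binds

lemma isBindable_iff_exists_binds {t : UBTree} : t.IsBindable ↔ ∃ m, t.Binds m := by
  refine ⟨fun h => ?_, fun ⟨_, hm⟩ => hm.isBindable⟩
  induction t with
  | var => exact ⟨id, by simp [Binds, Abstractions_var, Set.MapsTo]⟩
  | abs t ih =>
    obtain ⟨m, hm⟩ := ih h.2
    exact hm.exists_abs h.1
  | app t u iht ihu =>
    obtain ⟨m, hm⟩ := iht h.1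
    obtain ⟨m', hm'⟩ := ihu h.2
    exact hm.exists_app hm'

lemma IsBinding.exists_binds {t : UBTree} {m : t.Abstractions → t.Variables}
    (h : t.IsBinding m) : ∃ m' : List Bool → List Bool, t.Binds m' := by
  classical
  let m' : List Bool → List Bool := fun p => if hp : p ∈ t.Abstractions then m ⟨p, hp⟩ else []
  have hm' : ∀ p (hp : p ∈ t.Abstractions), m' p = m ⟨p, hp⟩ := fun p hp => dif_pos hp
  refine ⟨m', fun p hp => ?_, fun p hp q hq heq => ?_, fun p hp => ?_⟩
  · rw [hm' p hp]
    exact (m _).2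
  · rw [hm' p hp, hm' q hq] at heq
    exact congrArg Subtype.val (h.1 (Subtype.ext heq))
  · rw [hm' p hp]
    exact h.2 ⟨p, hp⟩

lemma Binds.isBinding {t : UBTree} {m : List Bool → List Bool} (h : t.Binds m) :
    t.IsBinding h.1.restrict :=
  ⟨h.1.restrict_inj.2 h.2.1, fun a => h.2.2 a.1 a.2⟩

theorem isClosedPlanar_iff (t : UBTree) :
    t.IsClosedPlanar ↔ t.IsBindable ∧ t.varCount = t.absCount := by
  have := t.finite_Variables.to_subtype
  rw [← ncard_Abstractions, ← ncard_Variables, ← Nat.card_coe_set_eq, ← Nat.card_coe_set_eq,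
    isBindable_iff_exists_binds]
  constructor
  · rintro ⟨m, hm, hsurj⟩
    exact ⟨hm.exists_binds, (Nat.card_eq_of_bijective m ⟨hm.1, hsurj⟩).symm⟩
  · rintro ⟨⟨m, hm⟩, hcard⟩
    exact ⟨_, hm.isBinding, (hm.isBinding.1.bijective_of_nat_card_le hcard.le).2⟩

/-! ### Closed planar `λ`-terms as trees of necklaces -/

/-- The limbs that encode a unary-binary tree: the vertices are `●●` at applications, `♦` at
abstractions and `▲` at variables, each reached from its `□`-pearl. -/
def limbs : UBTree → Limbs
  | var => free .triangle nil
  | abs t => edge .diamond .square t.limbs nil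
  | app t u => edge .disc .square t.limbs (edge .disc .square u.limbs nil)

lemma limbs_injective : Function.Injective limbs := by
  intro t u h
  induction t generalizing u with
  | var => cases u <;> simp_all [limbs]
  | abs t ih =>
    cases u <;> simp only [limbs, edge.injEq, reduceCtorEq, true_and, and_true, and_false] at h
    rw [ih h]
  | app t t' iht iht' =>
    cases u <;> simp only [limbs, edge.injEq, reduceCtorEq, true_and, and_true, and_false] at h
    rw [iht h.1, iht' h.2]

lemma excess_limbs (t : UBTree) : excess t.limbs.pearls = t.varCount - t.absCount := by
  induction t with
  | var => simp [limbs, pearls, varCount, absCount]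
  | abs t ih =>
    simp only [limbs, pearls, excess_diamond_cons, excess_square_cons, excess_append, excess_nil,
      ih, varCount, absCount]
    push_cast
    ring
  | app t u iht ihu =>
    simp only [limbs, pearls, excess_disc_cons, excess_square_cons, excess_append, excess_nil,
      iht, ihu, varCount, absCount]
    push_cast
    ring

lemma count_diamond_limbs (t : UBTree) : t.limbs.pearls.count .diamond = t.absCount := by
  induction t with
  | var => rfl
  | abs t ih => simp [limbs, pearls, absCount, ih]
  | app t u iht ihu => simp [limbs, pearls, absCount, iht, ihu]

lemma length_vertices_limbs (t : UBTree) :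
    t.limbs.vertices.length + 2 = 2 * t.varCount + t.absCount := by
  induction t with
  | var => rfl
  | abs t ih =>
    simp only [limbs, vertices, varCount, absCount, List.append_nil, List.length_cons]
    omega
  | app t u iht ihu =>
    simp only [limbs, vertices, varCount, absCount, List.append_nil, List.length_cons,
      List.length_append]
    omega

lemma IsBindable.absCount_le {t : UBTree} (h : t.IsBindable) : t.absCount ≤ t.varCount := by
  obtain ⟨m, hm⟩ := isBindable_iff_exists_binds.1 h
  exact hm.absCount_le

lemma nonNeg_limbs (t : UBTree) : t.limbs.NonNeg ↔ t.IsBindable := by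
  induction t with
  | var => simp [limbs, Limbs.NonNeg, IsBindable]
  | abs t ih =>
    simp only [limbs, Limbs.NonNeg, excess_diamond_cons, excess_square_cons, excess_limbs, ih,
      IsBindable, and_true, ← and_assoc]
    exact and_congr_left fun _ => by omega
  | app t u iht ihu =>
    simp only [limbs, Limbs.NonNeg, excess_disc_cons, excess_square_cons, excess_limbs, iht, ihu,
      IsBindable, and_true, sub_nonneg, Nat.cast_le]
    exact ⟨fun h => ⟨h.2.2.1, h.2.2.2.2.2⟩, fun ⟨ht, hu⟩ => ⟨ht.absCount_le, ht.absCount_le, ht,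
      hu.absCount_le, hu.absCount_le, hu⟩⟩

lemma isNecklace_limbs (t : UBTree) : IsNecklace Qlambda (.square :: t.limbs.row) ∧
    ∀ c ∈ t.limbs.vertices, IsNecklace Qlambda c := by
  induction t with
  | var => simp [limbs, row, vertices, isNecklace_Qlambda_iff]
  | abs t ih =>
    refine ⟨by simp [limbs, row, isNecklace_Qlambda_iff], ?_⟩
    simpa [limbs, vertices] using ih
  | app t u iht ihu =>
    refine ⟨by simp [limbs, row, isNecklace_Qlambda_iff], ?_⟩
    simp only [limbs, vertices, List.append_nil, List.forall_mem_cons, List.forall_mem_append]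
    exact ⟨iht.1, iht.2, ihu⟩

lemma all_limbs (t : UBTree) : t.limbs.All QEdge (· = .triangle) := by
  induction t <;> simp_all [limbs, Limbs.All, QEdge, Joins]

end UBTree

lemma eq_edge_of_row_eq_cons {x : Pearl} {w : List Pearl} {L : Limbs} (hx : x ≠ .square)
    (hx' : x ≠ .triangle) (hrow : L.row = x :: w) (hall : L.All QEdge (· = .triangle)) :
    ∃ S R, L = edge x .square S R ∧ R.row = w := by
  cases L with
  | nil => cases hrow
  | free z R =>
    obtain ⟨rfl, -⟩ := List.cons.inj hrow
    exact (hx' hall.1).elim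
  | edge z y S R =>
    obtain ⟨rfl, hR⟩ := List.cons.inj hrow
    obtain rfl : y = .square := by
      rcases hall.1 with (⟨-, h⟩ | ⟨h, -⟩) | (⟨-, h⟩ | ⟨h, -⟩)
      exacts [h, (hx h).elim, h, (hx h).elim]
    exact ⟨S, R, rfl, hR⟩

namespace UBTree

lemma exists_limbs_eq {L : Limbs} (hall : L.All QEdge (· = .triangle))
    (hroot : IsNecklace Qlambda (.square :: L.row))
    (hvert : ∀ c ∈ L.vertices, IsNecklace Qlambda c) : ∃ t : UBTree, t.limbs = L := by
  induction hn : L.vertices.length using Nat.strong_induction_on generalizing L with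
  | _ n ih =>
  subst hn
  have hrow : L.row = [.disc, .disc] ∨ L.row = [.triangle] ∨ L.row = [.diamond] := by
    simpa [isNecklace_Qlambda_iff] using hroot
  rcases hrow with hrow | hrow | hrow
  · obtain ⟨S, R, rfl, hR⟩ := eq_edge_of_row_eq_cons (by simp) (by simp) hrow hall
    obtain ⟨S', R, rfl, hR'⟩ := eq_edge_of_row_eq_cons (by simp) (by simp) hR hall.2.2
    obtain rfl := eq_nil_of_row hR'
    simp only [vertices, List.append_nil, List.length_cons, List.length_append] at ih
    simp only [vertices, List.append_nil, List.forall_mem_cons, List.forall_mem_append] at hvert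
    obtain ⟨t, rfl⟩ := ih _ (by omega) hall.2.1 hvert.1 hvert.2.1 rfl
    obtain ⟨u, rfl⟩ := ih _ (by omega) hall.2.2.2.1 hvert.2.2.1 hvert.2.2.2 rfl
    exact ⟨app t u, rfl⟩
  · obtain rfl | ⟨y, S, rfl⟩ := row_eq_singleton hrow
    · exact ⟨var, rfl⟩
    · simpa [QEdge, Joins] using hall.1
  · obtain ⟨S, R, rfl, hR⟩ := eq_edge_of_row_eq_cons (by simp) (by simp) hrow hall
    obtain rfl := eq_nil_of_row hR
    simp only [vertices, List.append_nil, List.length_cons] at ih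
    simp only [vertices, List.append_nil, List.forall_mem_cons] at hvert
    obtain ⟨t, rfl⟩ := ih _ (by omega) hall.2.1 hvert.1 hvert.2 rfl
    exact ⟨abs t, rfl⟩

/-- The tree of necklaces that encodes a unary-binary tree, rooted at the `□`-pearl of the vertex
of its root. -/
def toPearlTree (t : UBTree) : PearlTree := ⟨.square, t.limbs⟩

lemma toPearlTree_injective : Function.Injective toPearlTree := fun _ _ h =>
  limbs_injective (PearlTree.mk.inj h).2

lemma hasNecklacesIn_toPearlTree (t : UBTree) : t.toPearlTree.HasNecklacesIn Qlambda :=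
  List.forall_mem_cons.2 t.isNecklace_limbs

lemma toPearlTree_mem_F₀ {t : UBTree} : t.toPearlTree ∈ F₀ Qlambda ↔ t.IsClosedPlanar := by
  have hbalance : excess t.toPearlTree.limbs.pearls = 0 ↔ t.varCount = t.absCount := by
    rw [toPearlTree, excess_limbs]
    omega
  rw [mem_F₀, isClosedPlanar_iff, hbalance, ← nonNeg_limbs]
  exact ⟨fun h => h.2.2.2, fun h => ⟨rfl, t.hasNecklacesIn_toPearlTree, t.all_limbs, h⟩⟩

lemma size_toPearlTree (t : UBTree) : t.toPearlTree.size + 1 = 2 * t.varCount + t.absCount :=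
  t.length_vertices_limbs

lemma exists_toPearlTree {τ : PearlTree} (h : τ ∈ F₀ Qlambda) : ∃ t, toPearlTree t = τ := by
  obtain ⟨hsquare, hQ, hall, -⟩ := mem_F₀.1 h
  obtain ⟨x, L⟩ := τ
  obtain rfl : x = .square := hsquare
  obtain ⟨hroot, hvert⟩ := List.forall_mem_cons.1 hQ
  obtain ⟨t, rfl⟩ := exists_limbs_eq hall hroot hvert
  exact ⟨t, rfl⟩

lemma IsClosedPlanar.ncard_Abstractions_eq_iff {t : UBTree} (h : t.IsClosedPlanar) {n : ℕ}
    (hn : 1 ≤ n) : t.Abstractions.ncard = n ↔ t.toPearlTree.size = 3 * n - 1 := by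
  have hcount := ((isClosedPlanar_iff t).1 h).2
  have hsize := t.size_toPearlTree
  rw [ncard_Abstractions]
  omega

lemma toPearlTree_image {n : ℕ} (hn : 1 ≤ n) :
    toPearlTree '' closedPlanarTerms n = {τ ∈ F₀ Qlambda | τ.size = 3 * n - 1} := by
  ext τ
  constructor
  · rintro ⟨t, ⟨hclosed, hcard⟩, rfl⟩
    exact ⟨toPearlTree_mem_F₀.2 hclosed, (hclosed.ncard_Abstractions_eq_iff hn).1 hcard⟩
  · rintro ⟨hτ, hsize⟩
    obtain ⟨t, rfl⟩ := exists_toPearlTree hτ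
    have hclosed := toPearlTree_mem_F₀.1 hτ
    exact ⟨t, ⟨hclosed, (hclosed.ncard_Abstractions_eq_iff hn).2 hsize⟩, rfl⟩

end UBTree

lemma ncard_F₀diamond {Q : Set (List Bead)} {s n : ℕ}
    (h : ∀ τ ∈ F₀ Q, τ.size = s → τ.pearls.count .diamond = n) :
    {p ∈ F₀diamond Q | p.1.size = s}.ncard = {τ ∈ F₀ Q | τ.size = s}.ncard * n := by
  let marks : {p ∈ F₀diamond Q | p.1.size = s} ≃
      Σ τ : {τ ∈ F₀ Q | τ.size = s}, {k : ℕ // τ.1.pearls[k]? = some Pearl.diamond} :=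
    { toFun p := ⟨⟨p.1.1, p.2.1.1, p.2.2⟩, p.1.2, p.2.1.2⟩
      invFun p := ⟨(p.1.1, p.2.1), ⟨p.1.2.1, p.2.2⟩, p.1.2.2⟩
      left_inv _ := rfl
      right_inv _ := rfl }
  have fibres := Equiv.sigmaCongrRight fun τ : {τ ∈ F₀ Q | τ.size = s} =>
    (positionEquiv τ.1.pearls Pearl.diamond).trans (finCongr (h τ.1 τ.2.1 τ.2.2))
  rw [← Nat.card_coe_set_eq, ← Nat.card_coe_set_eq,
    Nat.card_congr ((marks.trans fibres).trans (Equiv.sigmaEquivProd _ _)), Nat.card_prod,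
    Nat.card_fin]

open UBTree in
lemma count_diamond_of_mem_F₀_Qlambda {n : ℕ} (hn : 1 ≤ n) {τ : PearlTree}
    (hτ : τ ∈ F₀ Qlambda) (hsize : τ.size = 3 * n - 1) : τ.pearls.count .diamond = n := by
  obtain ⟨t, ⟨-, ht⟩, rfl⟩ := (toPearlTree_image hn).ge ⟨hτ, hsize⟩
  rw [← ht, ncard_Abstractions, ← count_diamond_limbs]
  exact List.count_cons_of_ne (by simp [toPearlTree])

open UBTree in
theorem closedPlanarTerms_count {n : ℕ} (hn : 1 ≤ n) :
    (closedPlanarTerms n).Finite ∧ ((closedPlanarTerms n).ncard : ℚ) =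
      ((genFun (Csquare Qlambda) PearlTree.size).coeff (3 * n - 1) : ℚ) / (n + 1) := by
  have hinj := toPearlTree_injective.injOn (s := closedPlanarTerms n)
  refine ⟨Set.Finite.of_finite_image (toPearlTree_image hn ▸ finiteBySize_F₀ _ _) hinj, ?_⟩
  have hcoeff : (genFun (Csquare Qlambda) PearlTree.size).coeff (3 * n - 1) =
      (closedPlanarTerms n).ncard * (n + 1) := by
    rw [← genFun_F₀_add_genFun_F₀diamond, map_add, coeff_genFun, coeff_genFun,
      ncard_F₀diamond fun _ => count_diamond_of_mem_F₀_Qlambda hn, ← toPearlTree_image hn,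
      hinj.ncard_image]
    ring
  rw [hcoeff, eq_div_iff (by positivity)]
  push_cast
  rfl

theorem mainTheorem6 :
    (∀ Q : Set (List Bead),
      (∃ φ : (F₀ Q ⊕ F₀diamond Q) ≃ ((B₀ Q ∪ U₀ Q : Set PearlTree)),
        (∀ τ : F₀ Q, (φ (Sum.inl τ)).1 ∈ B₀ Q ∧
          (φ (Sum.inl τ)).1.necklaces = τ.1.necklaces) ∧
        (∀ p : F₀diamond Q, (φ (Sum.inr p)).1 ∈ U₀ Q ∧
          (φ (Sum.inr p)).1.necklaces = p.1.1.necklaces)) ∧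
      Disjoint (B₀ Q) (U₀ Q) ∧
      B₀ Q ∪ U₀ Q = Csquare Q ∧
      (∀ n, {τ ∈ F₀ Q | τ.size = n}.Finite ∧
        {p ∈ F₀diamond Q | p.1.size = n}.Finite ∧
        {τ ∈ Csquare Q | τ.size = n}.Finite) ∧
      genFun (F₀ Q) PearlTree.size + genFun (F₀diamond Q) (fun p => p.1.size) =
        genFun (Csquare Q) PearlTree.size) ∧
    (∀ C : ℤ⟦X⟧,
      C * (1 - PowerSeries.X * C) * (1 - 2 * PowerSeries.X * C) = 2 * PowerSeries.X ^ 2 ↔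
        C = (genFun (Csquare Qlambda) PearlTree.size).map (Nat.castRingHom ℤ)) ∧
    (∀ n : ℕ, 1 ≤ n →
      (closedPlanarTerms n).Finite ∧
      ((closedPlanarTerms n).ncard : ℚ) =
        ((genFun (Csquare Qlambda) PearlTree.size).coeff (3 * n - 1) : ℚ) / (n + 1)) := by
  refine ⟨fun Q => ⟨exists_necklacePreserving_equiv Q, disjoint_B₀_U₀ Q, B₀_union_U₀ Q,
    fun n => ⟨finiteBySize_F₀ Q n, finiteBySize_F₀diamond Q n, finiteBySize_Csquare Q n⟩,
    genFun_F₀_add_genFun_F₀diamond Q⟩, Csquare_Qlambda_cubic_iff,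
    fun n hn => closedPlanarTerms_count hn⟩
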